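/- Let $p>1$, write $y^{(p-1)}=|y|^{p-1}\operatorname{sgn}y$, and let $\pi_p=\int_0^1\frac{2\,dt}{(1-t^p)^{1/p}}$. Let $S_p$ be the generalized sine function: on $[0,\pi_p/2]$ it is the inverse function of $s\mapsto\int_0^s\frac{dt}{(1-t^p)^{1/p}}$, $s\in[0,1]$; it is extended to $\mathbb R$ by $S_p(x)=S_p(\pi_p-x)$ on $[\pi_p/2,\pi_p]$, $S_p(x)=-S_p(x-\pi_p)$ on $[\pi_p,2\pi_p]$, and $2\pi_p$-periodicity. Let $q,w\in C^1[0,1]$ with $w>0$ on $[0,1]$, and let $\alpha\in[0,\pi_p)$, $\beta\in(0,\pi_p]$. Consider the boundary conditions $$S_p'(\alpha)y(0)-S_p(\alpha)y'(0)=0,\qquad S_p'(\beta)y(1)-S_p(\beta)y'(1)=0.\tag{BC}$$ Solutions below are functions $y\in C^1[0,1]$ with $y'^{(p-1)}$ differentiable on $(0,1)$. The eigenvalue problem $$-(y'^{(p-1)})'=(p-1)(\lambda w(x)-q(x))y^{(p-1)}\ \text{ on }(0,1),\quad\text{(BC)},$$ has as its eigenvalues (the $\lambda\in\mathbb R$ for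 which a nontrivial solution exists) exactly the terms of a sequence $\lambda_0<\lambda_1<\lambda_2<\cdots\to\infty$, and every eigenfunction for $\lambda_n$ has exactly $n$ zeros in $(0,1)$. Moreover, let $f\in C(\mathbb R)$ satisfy $f(s)>0$ and $f(-s)=-f(s)$ for $s>0$, be locally Lipschitz continuous on $(0,\infty)$, and be such that the limits of $f(s)/s^{p-1}$ as $s\to0^+$ and as $s\to\infty$ exist in $[0,\infty]$. Consider the problem $$-(y'^{(p-1)})'+(p-1)q(x)y^{(p-1)}=(p-1)w(x)f(y)\ \text{ on }(0,1),\quad\text{(BC)}.\tag{P}$$ Then the following hold. (i) If, for some integer $n\ge0$, $\frac{f(s)}{s^{p-1}}<\lambda_n$ for all $s\in(0,\infty)$, then (P) has no solution with exactly $i$ zeros in $(0,1)$ for any integer $i\ge n$. (ii) If, for some integer $n\ge0$, $\frac{f(s)}{s^{p-1}}>\lambda_n$ for all $s\in(0,\infty)$, then (P) has no solution with exactly $i$ zeros in $(0,1)$ for any integer $0\le i\le n$. (iii) If $\frac{f(s)}{s^{p-1}}\ne\lambda_n$ for all $s\in(0,\infty)$ and all integers $n\ge0$, then (P) has no nontrivial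 solution. -/

import Mathlib

open Set Filter Topology

namespace PLap

noncomputable section

/-- The signed power `y^{(r)} = |y|^r sgn y`. -/
def spow (r y : ℝ) : ℝ := |y| ^ r * Real.sign y

/-- `x = ∫₀ˢ (1 - t^p)^{-1/p} dt`, for `0 ≤ s ≤ 1`. -/
def arcsinp (p s : ℝ) : ℝ := ∫ t in (0 : ℝ)..s, 1 / (1 - t ^ p) ^ (1 / p)

/-- `π_p = ∫₀¹ 2 (1 - t^p)^{-1/p} dt`. -/
def pip (p : ℝ) : ℝ := ∫ t in (0 : ℝ)..1, 2 / (1 - t ^ p) ^ (1 / p)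

/-- The generalized sine on `[0, π_p / 2]`: the inverse function of `arcsinp p` on `[0, 1]`. -/
def sinpQuarter (p x : ℝ) : ℝ := Function.invFunOn (arcsinp p) (Icc 0 1) x

/-- The generalized sine on `[0, π_p]`, extended by `S_p(x) = S_p(π_p - x)`. -/
def sinpHalf (p x : ℝ) : ℝ :=
  if x ≤ pip p / 2 then sinpQuarter p x else sinpQuarter p (pip p - x)

/-- The generalized sine `S_p` on `ℝ`: `S_p(x) = -S_p(x - π_p)` on `[π_p, 2 π_p]`, and
`2 π_p`-periodic (`t ∈ [0, 2 π_p)` is the representative of `x` modulo `2 π_p`). -/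
def sinp (p x : ℝ) : ℝ :=
  let t := x - 2 * pip p * (⌊x / (2 * pip p)⌋ : ℤ)
  if t ≤ pip p then sinpHalf p t else -sinpHalf p (t - pip p)

/-- The derivative `y'` on `[0, 1]` (one-sided at the endpoints). -/
def dI (y : ℝ → ℝ) (x : ℝ) : ℝ := derivWithin y (Icc 0 1) x

/-- The flux `y'^{(p-1)}`. -/
def flux (p : ℝ) (y : ℝ → ℝ) (x : ℝ) : ℝ := spow (p - 1) (dI y x)

/-- The regularity asked of a classical solution: `y ∈ C¹[0,1]` and `y'^{(p-1)}` is
differentiable on `(0,1)`. -/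
structure IsRegular (p : ℝ) (y : ℝ → ℝ) : Prop where
  contDiffOn : ContDiffOn ℝ 1 y (Icc 0 1)
  flux_differentiableAt : ∀ x ∈ Ioo (0 : ℝ) 1, DifferentiableAt ℝ (flux p y) x

/-- The separated boundary conditions. -/
structure SeparatedBC (p α β : ℝ) (y : ℝ → ℝ) : Prop where
  left : deriv (sinp p) α * y 0 - sinp p α * dI y 0 = 0
  right : deriv (sinp p) β * y 1 - sinp p β * dI y 1 = 0

/-- `y` solves `-(y'^{(p-1)})' + (p-1) q y^{(p-1)} = (p-1) w f(y)` on `(0,1)` with the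
separated boundary conditions. -/
structure IsSolution (p : ℝ) (q w f : ℝ → ℝ) (α β : ℝ) (y : ℝ → ℝ) : Prop where
  regular : IsRegular p y
  equation : ∀ x ∈ Ioo (0 : ℝ) 1,
    -deriv (flux p y) x + (p - 1) * q x * spow (p - 1) (y x) = (p - 1) * w x * f (y x)
  bc : SeparatedBC p α β y

/-- `y` is not the zero function on `[0,1]`. -/
def NonzeroFun (y : ℝ → ℝ) : Prop := ∃ x ∈ Icc (0 : ℝ) 1, y x ≠ 0

/-- `y` is an eigenfunction, with eigenvalue `μ`, of
`-(y'^{(p-1)})' = (p-1) (μ w - q) y^{(p-1)}` on `(0,1)` with the separated boundary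
conditions. -/
structure IsEigenfunction (p : ℝ) (q w : ℝ → ℝ) (α β μ : ℝ) (y : ℝ → ℝ) : Prop where
  regular : IsRegular p y
  equation : ∀ x ∈ Ioo (0 : ℝ) 1,
    -deriv (flux p y) x = (p - 1) * (μ * w x - q x) * spow (p - 1) (y x)
  bc : SeparatedBC p α β y
  nontrivial : NonzeroFun y

def IsEigenvalue (p : ℝ) (q w : ℝ → ℝ) (α β μ : ℝ) : Prop :=
  ∃ y, IsEigenfunction p q w α β μ y

/-- `y` has exactly `i` zeros in `(0,1)`. -/
def HasZeros (y : ℝ → ℝ) (i : ℕ) : Prop := {x ∈ Ioo (0 : ℝ) 1 | y x = 0}.encard = i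

/-- Standing assumptions on the coefficients. -/
structure Coefficients (q w : ℝ → ℝ) : Prop where
  q_contDiffOn : ContDiffOn ℝ 1 q (Icc 0 1)
  w_contDiffOn : ContDiffOn ℝ 1 w (Icc 0 1)
  w_pos : ∀ x ∈ Icc (0 : ℝ) 1, 0 < w x

/-- Standing assumptions on the nonlinearity; the limits of `f(s)/s^{p-1}` at `0⁺` and at `∞`
are taken in `[0, ∞]`. -/
structure Nonlinearity (p : ℝ) (f : ℝ → ℝ) : Prop where
  continuous : Continuous f
  pos : ∀ s, 0 < s → 0 < f s
  odd : ∀ s, 0 < s → f (-s) = -f s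
  locallyLipschitzOn : LocallyLipschitzOn (Ioi 0) f
  lim_zero : ∃ f₀ : ENNReal,
    Tendsto (fun s => ENNReal.ofReal (f s / s ^ (p - 1))) (𝓝[>] 0) (𝓝 f₀)
  lim_infty : ∃ f₁ : ENNReal,
    Tendsto (fun s => ENNReal.ofReal (f s / s ^ (p - 1))) atTop (𝓝 f₁)

end

end PLap

/-!
The proof is a Prüfer transformation for the half-linear equation. With `r = p - 1` and the flux
`v = y'^{(r)}`, a nontrivial solution is written in weighted polar coordinates
`y = e^L sin ψ`, `v = e^{rL} cos ψ` with the *ordinary* sine and cosine; these coordinates respect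
the homogeneity `(y, v) ↦ (c y, c^r v)` of the equation, and the radius `e^L` is given by an
implicit function (`gauge`). For the potential `k` (`k = lam * w - q` in the eigenvalue problem)
the angle solves `ψ' = A(ψ) + k(x) B(ψ)` (`angleSpeed`), where
`A = r |cos|^{1 + 1/r} / (r cos² + sin²)` and `B = r |sin|^{1 + r} / (r cos² + sin²)`. Unlike the
system for `(y, v)`, this scalar equation has a bounded and Lipschitz right-hand side, so solutions
exist globally, are unique and can be compared.

* Zeros of `y` are the points where `ψ` meets `π ℤ`; there `ψ' = 1`, so every multiple of `π` is
  crossed once, upwards, and `ψ 1` determines the number of zeros (`IsAngle.encard_zeros`).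
* A boundary condition fixes `ψ` modulo `π` at an endpoint (`exists_isBoundaryAngle_iff`). All that
  matters about `S_p` is that `(S_p', S_p)` does not vanish (`sinp_nondegenerate`).
* For the eigenvalue problem the terminal angle `ψ 1` is a continuous, strictly increasing function
  of `lam` that covers `(0, ∞)` (`exists_shooting`); the eigenvalue `lam_n` is the preimage of
  `β₀ + n π`, where `β₀ ∈ (0, π]` represents the boundary condition at `1`.
* A nontrivial solution of the nonlinear problem never vanishes together with its flux, by an energy
  estimate that uses `w ∈ C¹` and needs no bound on `f` near `0` (`IsFlow.eq_zero`). Hence it has an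
  angle, for the potential `w f(|y|)/|y|^{p-1} - q` (`IsSolution.exists_isAngle`). Sturm comparison
  with the angle for `lam_n` gives fewer than `n` zeros if `f(s)/s^{p-1} < lam_n` for all `s > 0`,
  and more than `n` if `>` holds. If `f(s)/s^{p-1}` avoids all eigenvalues, a nontrivial
  solution with `i` zeros would, by the intermediate value theorem for `f(s)/s^{p-1}` and
  `lam_i`, have fewer or more than `i` zeros.
-/

namespace PLap

noncomputable section

/-! ### Signed powers -/

theorem spow_zero (r : ℝ) : spow r 0 = 0 := by simp [spow]

theorem spow_neg (r y : ℝ) : spow r (-y) = -spow r y := by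
  simp [spow, Real.sign_neg]

theorem spow_of_pos {y : ℝ} (r : ℝ) (hy : 0 < y) : spow r y = y ^ r := by
  simp [spow, Real.sign_of_pos hy, abs_of_pos hy]

theorem abs_spow {r : ℝ} (hr : 0 < r) (y : ℝ) : |spow r y| = |y| ^ r := by
  rcases lt_trichotomy y 0 with h | h | h
  · obtain ⟨z, rfl⟩ : ∃ z, y = -z := ⟨-y, by ring⟩
    rw [spow_neg, abs_neg, abs_neg, spow_of_pos _ (by linarith), abs_of_pos (a := z) (by linarith),
      abs_of_pos (Real.rpow_pos_of_pos (by linarith) _)]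
  · simp [h, spow_zero, Real.zero_rpow hr.ne']
  · rw [spow_of_pos _ h, abs_of_pos h, abs_of_pos (Real.rpow_pos_of_pos h _)]

theorem spow_eq_zero {r : ℝ} (hr : 0 < r) {y : ℝ} : spow r y = 0 ↔ y = 0 := by
  rw [← abs_eq_zero, abs_spow hr, Real.rpow_eq_zero (abs_nonneg _) hr.ne', abs_eq_zero]

theorem spow_mul_of_pos {c : ℝ} (r : ℝ) (hc : 0 < c) (y : ℝ) :
    spow r (c * y) = c ^ r * spow r y := by
  have : Real.sign (c * y) = Real.sign y := by
    rcases lt_trichotomy y 0 with h | h | h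
    · rw [Real.sign_of_neg h, Real.sign_of_neg (mul_neg_of_pos_of_neg hc h)]
    · simp [h]
    · rw [Real.sign_of_pos h, Real.sign_of_pos (mul_pos hc h)]
  rw [spow, this, abs_mul, abs_of_pos hc, Real.mul_rpow hc.le (abs_nonneg _), spow, mul_assoc]

theorem spow_spow {r s : ℝ} (h : r * s = 1) (y : ℝ) : spow s (spow r y) = y := by
  have key : ∀ z : ℝ, 0 < z → spow s (spow r z) = z := fun z hz => by
    rw [spow_of_pos _ hz, spow_of_pos _ (Real.rpow_pos_of_pos hz _), ← Real.rpow_mul hz.le, h,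
      Real.rpow_one]
  rcases lt_trichotomy y 0 with hy | hy | hy
  · obtain ⟨z, rfl⟩ : ∃ z, y = -z := ⟨-y, by ring⟩
    rw [spow_neg, spow_neg, key z (by linarith)]
  · simp [hy, spow_zero]
  · exact key y hy

theorem mul_spow_self {r : ℝ} (hr : 0 < r) (y : ℝ) : y * spow r y = |y| ^ (r + 1) := by
  have key : ∀ z : ℝ, 0 < z → z * spow r z = |z| ^ (r + 1) := fun z hz => by
    rw [spow_of_pos _ hz, abs_of_pos hz, Real.rpow_add_one hz.ne', mul_comm]
  rcases lt_trichotomy y 0 with hy | hy | hy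
  · obtain ⟨z, rfl⟩ : ∃ z, y = -z := ⟨-y, by ring⟩
    rw [spow_neg, neg_mul_neg, key z (by linarith), abs_neg]
  · simp [hy, Real.zero_rpow (by linarith : r + 1 ≠ 0)]
  · exact key y hy

theorem hasDerivAt_abs_rpow_add_one {r : ℝ} (hr : 0 < r) (y : ℝ) :
    HasDerivAt (fun x : ℝ => |x| ^ (r + 1)) ((r + 1) * spow r y) y := by
  have h := hasDerivAt_abs_rpow y (p := r + 1) (by linarith)
  convert h using 1
  have key : ∀ z : ℝ, 0 < z → spow r z = |z| ^ (r + 1 - 2) * z := fun z hz => by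
    rw [spow_of_pos _ hz, abs_of_pos hz, ← Real.rpow_add_one hz.ne']
    ring_nf
  rw [mul_assoc]
  congr 1
  rcases lt_trichotomy y 0 with hy | hy | hy
  · obtain ⟨z, rfl⟩ : ∃ z, y = -z := ⟨-y, by ring⟩
    rw [spow_neg, key z (by linarith), abs_neg]
    ring
  · simp [hy, spow_zero]
  · exact key y hy

theorem contDiff_abs_rpow_add_one {r : ℝ} (hr : 0 < r) :
    ContDiff ℝ 1 (fun x : ℝ => |x| ^ (r + 1)) := by
  simpa using contDiff_norm_rpow (E := ℝ) (p := r + 1) (by linarith)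

theorem continuous_spow {r : ℝ} (hr : 0 < r) : Continuous (spow r) := by
  have h : spow r = fun y => (r + 1)⁻¹ * deriv (fun x : ℝ => |x| ^ (r + 1)) y := by
    funext y
    rw [(hasDerivAt_abs_rpow_add_one hr y).deriv]
    field_simp
  rw [h]
  exact continuous_const.mul ((contDiff_abs_rpow_add_one hr).continuous_deriv le_rfl)

/-! ### The vector field of the angle equation -/

/-- The Jacobian factor of the weighted polar coordinates `(e^L sin ψ, e^{rL} cos ψ)`. -/
def angleDen (r ψ : ℝ) : ℝ := r * Real.cos ψ ^ 2 + Real.sin ψ ^ 2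

/-- The part of the angular speed that does not depend on the potential. -/
def angleFree (r ψ : ℝ) : ℝ := r * |Real.cos ψ| ^ (r⁻¹ + 1) / angleDen r ψ

/-- The coefficient of the potential in the angular speed. -/
def anglePot (r ψ : ℝ) : ℝ := r * |Real.sin ψ| ^ (r + 1) / angleDen r ψ

theorem angleDen_pos {r : ℝ} (hr : 0 < r) (ψ : ℝ) : 0 < angleDen r ψ := by
  unfold angleDen
  by_cases h : Real.cos ψ = 0
  · have := Real.sin_sq_add_cos_sq ψ
    simp only [h] at this ⊢
    nlinarith
  · have : 0 < Real.cos ψ ^ 2 := by positivity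
    have := sq_nonneg (Real.sin ψ)
    positivity

theorem angleFree_nonneg {r : ℝ} (hr : 0 < r) (ψ : ℝ) : 0 ≤ angleFree r ψ := by
  have := angleDen_pos hr ψ
  unfold angleFree; positivity

theorem anglePot_nonneg {r : ℝ} (hr : 0 < r) (ψ : ℝ) : 0 ≤ anglePot r ψ := by
  have := angleDen_pos hr ψ
  unfold anglePot; positivity

theorem anglePot_pos {r : ℝ} (hr : 0 < r) {ψ : ℝ} (h : Real.sin ψ ≠ 0) : 0 < anglePot r ψ := by
  have := angleDen_pos hr ψ
  have := abs_pos.2 h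
  unfold anglePot; positivity

theorem anglePot_of_sin_eq_zero {r : ℝ} (hr : 0 < r) {ψ : ℝ} (h : Real.sin ψ = 0) :
    anglePot r ψ = 0 := by
  simp [anglePot, h, Real.zero_rpow (by linarith : r + 1 ≠ 0)]

theorem angleFree_of_sin_eq_zero {r : ℝ} (hr : 0 < r) {ψ : ℝ} (h : Real.sin ψ = 0) :
    angleFree r ψ = 1 := by
  have h2 := Real.sin_sq_add_cos_sq ψ
  have hc : |Real.cos ψ| = 1 := by
    rw [h] at h2
    rw [← sq_eq_sq₀ (abs_nonneg _) zero_le_one, sq_abs]; linarith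
  have : Real.cos ψ ^ 2 = 1 := by rw [h] at h2; linarith
  simp [angleFree, angleDen, hc, h, this, hr.ne']

theorem angleFree_add_anglePot_pos {r : ℝ} (hr : 0 < r) (ψ : ℝ) :
    0 < angleFree r ψ + anglePot r ψ := by
  by_cases h : Real.sin ψ = 0
  · rw [angleFree_of_sin_eq_zero hr h, anglePot_of_sin_eq_zero hr h]; norm_num
  · linarith [angleFree_nonneg hr ψ, anglePot_pos hr h]

theorem contDiff_angleDen (r : ℝ) : ContDiff ℝ 1 (angleDen r) := by
  unfold angleDen; fun_prop

theorem contDiff_angleFree {r : ℝ} (hr : 0 < r) : ContDiff ℝ 1 (angleFree r) :=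
  (contDiff_const.mul ((contDiff_abs_rpow_add_one (inv_pos.2 hr)).comp Real.contDiff_cos)).div
    (contDiff_angleDen r) fun ψ => (angleDen_pos hr ψ).ne'

theorem contDiff_anglePot {r : ℝ} (hr : 0 < r) : ContDiff ℝ 1 (anglePot r) :=
  (contDiff_const.mul ((contDiff_abs_rpow_add_one hr).comp Real.contDiff_sin)).div
    (contDiff_angleDen r) fun ψ => (angleDen_pos hr ψ).ne'

theorem periodic_angleFree (r : ℝ) : Function.Periodic (angleFree r) (2 * Real.pi) := fun ψ => by
  simp [angleFree, angleDen]

theorem periodic_anglePot (r : ℝ) : Function.Periodic (anglePot r) (2 * Real.pi) := fun ψ => by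
  simp [anglePot, angleDen]

theorem exists_bound_lipschitz_of_periodic {g : ℝ → ℝ} {T : ℝ} (hT : 0 < T) (hg : ContDiff ℝ 1 g)
    (hp : Function.Periodic g T) : ∃ K : NNReal, (∀ x, |g x| ≤ K) ∧ LipschitzWith K g := by
  have hb : ∀ u : ℝ → ℝ, Continuous u → Function.Periodic u T → ∃ C, ∀ x, |u x| ≤ C := by
    intro u hu hup
    obtain ⟨C, hC⟩ := (isCompact_Icc (a := (0 : ℝ)) (b := T)).exists_bound_of_continuousOn
      hu.continuousOn
    refine ⟨C, fun x => ?_⟩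
    obtain ⟨y, hy, hxy⟩ := hup.exists_mem_Ico₀ hT x
    rw [hxy]
    exact hC y ⟨hy.1, hy.2.le⟩
  have hd : Function.Periodic (deriv g) T := fun x => by
    have : (fun z => g (z + T)) = g := funext hp
    rw [← deriv_comp_add_const, this]
  obtain ⟨C₁, h₁⟩ := hb g hg.continuous hp
  obtain ⟨C₂, h₂⟩ := hb (deriv g) (hg.continuous_deriv le_rfl) hd
  refine ⟨Real.toNNReal (max C₁ C₂), fun x => ?_, ?_⟩
  · exact ((h₁ x).trans (le_max_left _ _)).trans (Real.le_coe_toNNReal _)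
  · refine lipschitzWith_of_nnnorm_deriv_le (hg.differentiable one_ne_zero) fun x => ?_
    rw [← NNReal.coe_le_coe, coe_nnnorm]
    exact ((h₂ x).trans (le_max_right _ _)).trans (Real.le_coe_toNNReal _)

/-! ### The gauge of the weighted polar coordinates -/

/-- `(a, b)` lies on the unit circle after rescaling by `(e^{-L}, e^{-rL})` iff this is `1`. -/
def gaugeFun (r : ℝ) (z : (ℝ × ℝ) × ℝ) : ℝ :=
  (z.1.1 * Real.exp (-z.2)) ^ 2 + (z.1.2 * Real.exp (-(r * z.2))) ^ 2

theorem gaugeFun_strictAnti {r : ℝ} (hr : 0 < r) {u : ℝ × ℝ} (hu : u ≠ 0) :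
    StrictAnti fun L => gaugeFun r (u, L) := by
  intro L M h
  have h1 : Real.exp (-M) < Real.exp (-L) := Real.exp_lt_exp.2 (by linarith)
  have h2 : Real.exp (-(r * M)) < Real.exp (-(r * L)) := Real.exp_lt_exp.2 (by nlinarith)
  have h1' : Real.exp (-M) ^ 2 < Real.exp (-L) ^ 2 := by gcongr
  have h2' : Real.exp (-(r * M)) ^ 2 < Real.exp (-(r * L)) ^ 2 := by gcongr
  simp only [gaugeFun, mul_pow]
  by_cases ha : u.1 = 0
  · have hb : u.2 ≠ 0 := fun hb => hu (Prod.ext ha hb)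
    have : 0 < u.2 ^ 2 := by positivity
    nlinarith [sq_nonneg u.1]
  · have : 0 < u.1 ^ 2 := by positivity
    nlinarith [sq_nonneg u.2]

theorem continuous_gaugeFun (r : ℝ) (u : ℝ × ℝ) : Continuous fun L => gaugeFun r (u, L) := by
  unfold gaugeFun; fun_prop

theorem exists_gauge {r : ℝ} (hr : 0 < r) {u : ℝ × ℝ} (hu : u ≠ 0) :
    ∃ L, gaugeFun r (u, L) = 1 := by
  have hexp : ∀ c : ℝ, 0 < c → Tendsto (fun L : ℝ => Real.exp (-(c * L))) atTop (𝓝 0) := fun c hc =>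
    Real.tendsto_exp_neg_atTop_nhds_zero.comp (tendsto_id.const_mul_atTop hc)
  have hexp' : ∀ c : ℝ, 0 < c → Tendsto (fun L : ℝ => Real.exp (-(c * L))) atBot atTop :=
    fun c hc => Real.tendsto_exp_atTop.comp
      (tendsto_neg_atBot_atTop.comp (tendsto_id.const_mul_atBot hc))
  have htop : Tendsto (fun L => gaugeFun r (u, L)) atTop (𝓝 0) := by
    have h1 := ((hexp 1 one_pos).const_mul u.1).pow 2
    have h2 := ((hexp r hr).const_mul u.2).pow 2
    simpa [gaugeFun] using h1.add h2
  obtain ⟨M, hM⟩ := (htop.eventually (gt_mem_nhds one_pos)).exists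
  have hbot : ∃ L, 1 ≤ gaugeFun r (u, L) := by
    have key : ∀ a c : ℝ, a ≠ 0 → 0 < c → ∃ L : ℝ, 1 ≤ (a * Real.exp (-(c * L))) ^ 2 := by
      intro a c ha hc
      obtain ⟨L, hL⟩ := ((hexp' c hc).eventually_ge_atTop |a|⁻¹).exists
      refine ⟨L, ?_⟩
      rw [← sq_abs, abs_mul, abs_of_pos (Real.exp_pos _)]
      have : 1 ≤ |a| * Real.exp (-(c * L)) := by
        rw [inv_le_iff_one_le_mul₀ (abs_pos.2 ha)] at hL
        linarith
      nlinarith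
    by_cases ha : u.1 = 0
    · have hb : u.2 ≠ 0 := fun hb => hu (Prod.ext ha hb)
      obtain ⟨L, hL⟩ := key u.2 r hb hr
      exact ⟨L, by unfold gaugeFun; nlinarith [sq_nonneg (u.1 * Real.exp (-L))]⟩
    · obtain ⟨L, hL⟩ := key u.1 1 ha one_pos
      rw [one_mul] at hL
      exact ⟨L, by unfold gaugeFun; nlinarith [sq_nonneg (u.2 * Real.exp (-(r * L)))]⟩
  obtain ⟨L, hL⟩ := hbot
  obtain ⟨x, hx⟩ := mem_range_of_exists_le_of_exists_ge (continuous_gaugeFun r u) ⟨M, hM.le⟩ ⟨L, hL⟩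
  exact ⟨x, hx⟩

/-- The logarithmic radius `L` of `(a, b) ≠ 0` in the weighted polar coordinates
`(a, b) = (e^L sin ψ, e^{rL} cos ψ)`. -/
def gauge (r : ℝ) (u : ℝ × ℝ) : ℝ := Classical.epsilon fun L => gaugeFun r (u, L) = 1

theorem gaugeFun_gauge {r : ℝ} (hr : 0 < r) {u : ℝ × ℝ} (hu : u ≠ 0) :
    gaugeFun r (u, gauge r u) = 1 := Classical.epsilon_spec (exists_gauge hr hu)

/-- Uniqueness of the root identifies `gauge` with the local implicit function. -/
theorem differentiableAt_gauge {r : ℝ} (hr : 0 < r) {u : ℝ × ℝ} (hu : u ≠ 0) :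
    DifferentiableAt ℝ (gauge r) u := by
  have hcd : ContDiff ℝ 1 (gaugeFun r) := by unfold gaugeFun; fun_prop
  set z := (u, gauge r u) with hz
  have hs : HasStrictFDerivAt (gaugeFun r) (fderiv ℝ (gaugeFun r) z) z :=
    hcd.contDiffAt.hasStrictFDerivAt one_ne_zero
  have hpart : HasDerivAt (fun L => gaugeFun r (u, L))
      ((fderiv ℝ (gaugeFun r) z ∘L .inr ℝ (ℝ × ℝ) ℝ) 1) (gauge r u) := by
    have h2 : HasFDerivAt (fun L : ℝ => (u, L)) (.inr ℝ (ℝ × ℝ) ℝ) (gauge r u) :=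
      hasFDerivAt_prodMk_right u (gauge r u)
    exact (hs.hasFDerivAt.comp (gauge r u) h2).hasDerivAt
  have hpart' : HasDerivAt (fun L => gaugeFun r (u, L))
      (-2 * ((u.1 * Real.exp (-gauge r u)) ^ 2 + r * (u.2 * Real.exp (-(r * gauge r u))) ^ 2))
      (gauge r u) := by
    have e1 := ((((hasDerivAt_id (gauge r u)).neg).exp).const_mul u.1).pow 2
    have e2 := ((((hasDerivAt_id (gauge r u)).const_mul r).neg.exp).const_mul u.2).pow 2
    exact (e1.add e2).congr_deriv (by simp; ring)
  have hne : (fderiv ℝ (gaugeFun r) z ∘L .inr ℝ (ℝ × ℝ) ℝ) 1 ≠ 0 := by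
    rw [hpart.unique hpart']
    have hg := gaugeFun_gauge hr hu
    simp only [gaugeFun] at hg
    have : 0 < (u.1 * Real.exp (-gauge r u)) ^ 2 + r * (u.2 * Real.exp (-(r * gauge r u))) ^ 2 := by
      by_cases h : u.1 * Real.exp (-gauge r u) = 0
      · rw [h] at hg ⊢; nlinarith
      · positivity
    linarith
  have hinv : (fderiv ℝ (gaugeFun r) z ∘L .inr ℝ (ℝ × ℝ) ℝ).IsInvertible := by
    refine ⟨ContinuousLinearEquiv.unitsEquivAut ℝ (Units.mk0 _ hne), ?_⟩
    ext; simp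
  have heq : hs.implicitFunctionOfProdDomain hinv =ᶠ[𝓝 u] gauge r := by
    filter_upwards [hs.eventually_apply_implicitFunctionOfProdDomain hinv,
      isOpen_ne.mem_nhds hu] with x hx hx0
    rw [gaugeFun_gauge hr hu] at hx
    exact (gaugeFun_strictAnti hr hx0).injective (hx.trans (gaugeFun_gauge hr hx0).symm)
  have hd := (hs.hasStrictFDerivAt_implicitFunctionOfProdDomain hinv).hasFDerivAt.differentiableAt
  exact hd.congr_of_eventuallyEq heq.symm

/-! ### Scalar differential inequalities on the unit interval -/

theorem monotoneOn_of_hasDerivWithinAt_nonneg {f f' : ℝ → ℝ}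
    (hf : ∀ x ∈ Icc (0 : ℝ) 1, HasDerivWithinAt f (f' x) (Icc 0 1) x)
    (h0 : ∀ x ∈ Icc (0 : ℝ) 1, 0 ≤ f' x) : MonotoneOn f (Icc 0 1) := by
  have hd : ∀ x ∈ interior (Icc (0 : ℝ) 1), HasDerivAt f (f' x) x := fun x hx =>
    (hf x (interior_subset hx)).hasDerivAt (mem_interior_iff_mem_nhds.1 hx)
  refine monotoneOn_of_deriv_nonneg (convex_Icc 0 1) (fun x hx => (hf x hx).continuousWithinAt)
    (fun x hx => (hd x hx).differentiableAt.differentiableWithinAt) fun x hx => ?_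
  rw [(hd x hx).deriv]
  exact h0 x (interior_subset hx)

theorem hasDerivWithinAt_Ici_of_Icc {f : ℝ → ℝ} {f' x : ℝ} (hx : x ∈ Ico (0 : ℝ) 1)
    (h : HasDerivWithinAt f f' (Icc 0 1) x) : HasDerivWithinAt f f' (Ici x) x :=
  h.mono_of_mem_nhdsWithin
    (mem_of_superset (Icc_mem_nhdsGE hx.2) (Icc_subset_Icc_left hx.1))

section Comparison

variable {ψ₁ ψ₂ g₁ g₂ : ℝ → ℝ} {H : ℝ → ℝ → ℝ} {K : ℝ}

/-- Comparison for `ψ' = H(x, ψ)` with `H` Lipschitz in the second variable: a subsolution that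
starts below a supersolution stays below it. -/
theorem le_of_subsolution_of_supersolution
    (h₁ : ∀ x ∈ Icc (0 : ℝ) 1, HasDerivWithinAt ψ₁ (g₁ x) (Icc 0 1) x)
    (h₂ : ∀ x ∈ Icc (0 : ℝ) 1, HasDerivWithinAt ψ₂ (g₂ x) (Icc 0 1) x)
    (hH : ∀ x ∈ Icc (0 : ℝ) 1, ∀ s t, |H x s - H x t| ≤ K * |s - t|)
    (hg₁ : ∀ x ∈ Icc (0 : ℝ) 1, g₁ x ≤ H x (ψ₁ x))
    (hg₂ : ∀ x ∈ Icc (0 : ℝ) 1, H x (ψ₂ x) ≤ g₂ x) (h0 : ψ₁ 0 ≤ ψ₂ 0) :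
    ∀ x ∈ Icc (0 : ℝ) 1, ψ₁ x ≤ ψ₂ x := by
  intro x hx
  have key : ∀ δ : ℝ, 0 < δ → ψ₁ x - ψ₂ x ≤ δ * Real.exp ((K + 1) * x) := by
    intro δ hδ
    refine image_le_of_deriv_right_lt_deriv_boundary (f := fun x => ψ₁ x - ψ₂ x)
      (f' := fun x => g₁ x - g₂ x) (B := fun x => δ * Real.exp ((K + 1) * x))
      (B' := fun x => δ * (Real.exp ((K + 1) * x) * (K + 1))) (a := 0) (b := 1)
      (fun y hy => ((h₁ y hy).sub (h₂ y hy)).continuousWithinAt)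
      (fun y hy => hasDerivWithinAt_Ici_of_Icc hy
        ((h₁ y (Ico_subset_Icc_self hy)).sub (h₂ y (Ico_subset_Icc_self hy)))) ?_ ?_ ?_ hx
    · simp; linarith
    · intro y
      have h := (((hasDerivAt_id y).const_mul (K + 1)).exp).const_mul δ
      simpa using h
    · intro y hy hyB
      have hy' := Ico_subset_Icc_self hy
      have hpos : 0 < δ * Real.exp ((K + 1) * y) := by positivity
      have e1 := hH y hy' (ψ₁ y) (ψ₂ y)
      rw [hyB, abs_of_pos hpos] at e1
      have := le_abs_self (H y (ψ₁ y) - H y (ψ₂ y))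
      have := hg₁ y hy'
      have := hg₂ y hy'
      nlinarith
  have hlim : Tendsto (fun δ : ℝ => δ * Real.exp ((K + 1) * x)) (𝓝[>] 0) (𝓝 0) := by
    have : Tendsto (fun δ : ℝ => δ * Real.exp ((K + 1) * x)) (𝓝 0) (𝓝 (0 * _)) :=
      tendsto_id.mul_const _
    rw [zero_mul] at this
    exact this.mono_left nhdsWithin_le_nhds
  have := ge_of_tendsto hlim (eventually_mem_nhdsWithin.mono fun δ hδ => key δ hδ)
  linarith

/-- Strict comparison: if one of the differential inequalities is strict at a single point, the
subsolution ends strictly below the supersolution. -/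
theorem lt_of_subsolution_of_supersolution
    (h₁ : ∀ x ∈ Icc (0 : ℝ) 1, HasDerivWithinAt ψ₁ (g₁ x) (Icc 0 1) x)
    (h₂ : ∀ x ∈ Icc (0 : ℝ) 1, HasDerivWithinAt ψ₂ (g₂ x) (Icc 0 1) x)
    (hH : ∀ x ∈ Icc (0 : ℝ) 1, ∀ s t, |H x s - H x t| ≤ K * |s - t|)
    (hg₁ : ∀ x ∈ Icc (0 : ℝ) 1, g₁ x ≤ H x (ψ₁ x))
    (hg₂ : ∀ x ∈ Icc (0 : ℝ) 1, H x (ψ₂ x) ≤ g₂ x) (h0 : ψ₁ 0 ≤ ψ₂ 0)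
    (hs : ∃ x ∈ Icc (0 : ℝ) 1, g₁ x < H x (ψ₁ x) ∨ H x (ψ₂ x) < g₂ x) : ψ₁ 1 < ψ₂ 1 := by
  have hle := le_of_subsolution_of_supersolution h₁ h₂ hH hg₁ hg₂ h0
  have one_mem : (1 : ℝ) ∈ Icc (0 : ℝ) 1 := ⟨zero_le_one, le_rfl⟩
  refine lt_of_le_of_ne (hle 1 one_mem) fun heq => ?_
  -- `(ψ₂ - ψ₁) e^{Kx}` is nonnegative and nondecreasing: if it vanishes at `1`, it is zero
  have hmono : MonotoneOn (fun x => (ψ₂ x - ψ₁ x) * Real.exp (K * x)) (Icc 0 1) := by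
    refine monotoneOn_of_hasDerivWithinAt_nonneg (f' := fun x => (g₂ x - g₁ x) * Real.exp (K * x) +
      (ψ₂ x - ψ₁ x) * (Real.exp (K * x) * K)) (fun x hx => ?_) fun x hx => ?_
    · have he := (((hasDerivAt_id x).const_mul K).exp).hasDerivWithinAt (s := Icc (0 : ℝ) 1)
      have := ((h₂ x hx).sub (h₁ x hx)).mul he
      exact this.congr_deriv (by simp)
    · have e1 := hH x hx (ψ₂ x) (ψ₁ x)
      have hd := hle x hx
      rw [abs_of_nonneg (by linarith : 0 ≤ ψ₂ x - ψ₁ x)] at e1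
      have := neg_abs_le (H x (ψ₂ x) - H x (ψ₁ x))
      have := hg₁ x hx
      have := hg₂ x hx
      have h2 : 0 ≤ g₂ x - g₁ x + (ψ₂ x - ψ₁ x) * K := by linarith
      have := mul_nonneg h2 (Real.exp_pos (K * x)).le
      linarith
  have hall : ∀ x ∈ Icc (0 : ℝ) 1, ψ₁ x = ψ₂ x := fun x hx => by
    have h := hmono hx one_mem hx.2
    simp only [heq, sub_self, zero_mul] at h
    have := nonpos_of_mul_nonpos_left h (Real.exp_pos (K * x))
    linarith [hle x hx]
  obtain ⟨x, hx, hlt⟩ := hs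
  have heq' : g₁ x = g₂ x :=
    (uniqueDiffOn_Icc zero_lt_one x hx).eq_deriv _ (h₁ x hx)
      ((h₂ x hx).congr hall (hall x hx))
  have := hg₁ x hx
  have := hg₂ x hx
  rw [hall x hx] at *
  rcases hlt with h | h <;> linarith

end Comparison

/-! ### The angle equation -/

/-- The angular speed of a solution of the half-linear equation with potential `k`. -/
def angleSpeed (r k ψ : ℝ) : ℝ := angleFree r ψ + k * anglePot r ψ

/-- `ψ` is an angle function on `[0, 1]` for the potential `k`. -/
def IsAngle (r : ℝ) (k ψ : ℝ → ℝ) : Prop :=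
  ∀ x ∈ Icc (0 : ℝ) 1, HasDerivWithinAt ψ (angleSpeed r (k x) (ψ x)) (Icc 0 1) x

theorem IsAngle.continuousOn {r : ℝ} {k ψ : ℝ → ℝ} (h : IsAngle r k ψ) :
    ContinuousOn ψ (Icc 0 1) := fun x hx => (h x hx).continuousWithinAt

theorem exists_bound_lipschitz_angle {r : ℝ} (hr : 0 < r) : ∃ K : NNReal,
    (∀ ψ, angleFree r ψ ≤ K) ∧ (∀ ψ, anglePot r ψ ≤ K) ∧
      ∀ k : ℝ, LipschitzWith (K + ‖k‖₊ * K) (angleSpeed r k) := by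
  obtain ⟨K₁, b₁, l₁⟩ := exists_bound_lipschitz_of_periodic Real.two_pi_pos (contDiff_angleFree hr)
    (periodic_angleFree r)
  obtain ⟨K₂, b₂, l₂⟩ := exists_bound_lipschitz_of_periodic Real.two_pi_pos (contDiff_anglePot hr)
    (periodic_anglePot r)
  refine ⟨max K₁ K₂, fun ψ => ?_, fun ψ => ?_, fun k => ?_⟩
  · exact ((le_abs_self _).trans (b₁ ψ)).trans (by exact_mod_cast le_max_left K₁ K₂)
  · exact ((le_abs_self _).trans (b₂ ψ)).trans (by exact_mod_cast le_max_right K₁ K₂)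
  · exact (l₁.weaken (le_max_left _ _)).add
      ((lipschitzWith_smul k).comp (l₂.weaken (le_max_right _ _)))

theorem exists_lipschitz_angleSpeed {r : ℝ} (hr : 0 < r) {k : ℝ → ℝ}
    (hk : ContinuousOn k (Icc 0 1)) : ∃ K : NNReal, ∀ x ∈ Icc (0 : ℝ) 1,
      LipschitzWith K (angleSpeed r (k x)) := by
  obtain ⟨K, -, -, hl⟩ := exists_bound_lipschitz_angle hr
  obtain ⟨M, hM⟩ := isCompact_Icc.exists_bound_of_continuousOn hk
  refine ⟨K + M.toNNReal * K, fun x hx => (hl (k x)).weaken ?_⟩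
  gcongr
  exact NNReal.le_toNNReal_of_coe_le (hM x hx)

theorem exists_isAngle {r : ℝ} (hr : 0 < r) {k : ℝ → ℝ} (hk : ContinuousOn k (Icc 0 1)) (ψ₀ : ℝ) :
    ∃ ψ, ψ 0 = ψ₀ ∧ IsAngle r k ψ := by
  obtain ⟨K, hK⟩ := exists_lipschitz_angleSpeed hr hk
  obtain ⟨C, hC₁, hC₂, -⟩ := exists_bound_lipschitz_angle hr
  obtain ⟨M, hM⟩ := isCompact_Icc.exists_bound_of_continuousOn hk
  -- the vector field is bounded, so a solution cannot leave a ball of radius equal to the bound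
  have hpl : IsPicardLindelof (fun x => angleSpeed r (k x)) (tmin := 0) (tmax := 1)
      ⟨0, by simp⟩ ψ₀ (C + M.toNNReal * C) 0 (C + M.toNNReal * C) K := by
    refine ⟨fun x hx => (hK x hx).lipschitzOnWith, fun ψ _ => ?_, fun x hx ψ _ => ?_, by simp⟩
    · exact continuousOn_const.add (hk.mul continuousOn_const)
    · have h1 := hC₁ ψ
      have h2 := hC₂ ψ
      have h3 := hM x hx
      rw [angleSpeed]
      refine (norm_add_le _ _).trans ?_
      rw [norm_mul, Real.norm_of_nonneg (angleFree_nonneg hr ψ),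
        Real.norm_of_nonneg (anglePot_nonneg hr ψ)]
      push_cast
      gcongr
      · exact anglePot_nonneg hr ψ
      · exact h3.trans (Real.le_coe_toNNReal M)
  obtain ⟨ψ, h0, h⟩ := hpl.exists_eq_forall_mem_Icc_hasDerivWithinAt₀
  exact ⟨ψ, h0, h⟩

theorem IsAngle.exists_sin_ne_zero {r : ℝ} (hr : 0 < r) {k ψ : ℝ → ℝ} (h : IsAngle r k ψ) :
    ∃ x ∈ Icc (0 : ℝ) 1, Real.sin (ψ x) ≠ 0 := by
  by_contra! hc
  have h0 : (0 : ℝ) ∈ Icc (0 : ℝ) 1 := ⟨le_rfl, zero_le_one⟩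
  have h1 := (h 0 h0).sin
  have h2 : HasDerivWithinAt (fun x => Real.sin (ψ x)) 0 (Icc 0 1) 0 :=
    (hasDerivWithinAt_const _ _ (0 : ℝ)).congr hc (hc 0 h0)
  have h3 := (uniqueDiffOn_Icc zero_lt_one 0 h0).eq_deriv _ h1 h2
  rw [angleSpeed, angleFree_of_sin_eq_zero hr (hc 0 h0), anglePot_of_sin_eq_zero hr (hc 0 h0)] at h3
  have := Real.sin_sq_add_cos_sq (ψ 0)
  rw [hc 0 h0] at this
  simp at h3
  simp [h3] at this

theorem angleSpeed_le {r : ℝ} (hr : 0 < r) {k₁ k₂ ψ : ℝ} (h : Real.sin ψ ≠ 0 → k₁ ≤ k₂) :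
    angleSpeed r k₁ ψ ≤ angleSpeed r k₂ ψ := by
  unfold angleSpeed
  by_cases hs : Real.sin ψ = 0
  · simp [anglePot_of_sin_eq_zero hr hs]
  · have := mul_le_mul_of_nonneg_right (h hs) (anglePot_nonneg hr ψ)
    linarith

theorem angleSpeed_lt {r : ℝ} (hr : 0 < r) {k₁ k₂ ψ : ℝ} (hs : Real.sin ψ ≠ 0) (h : k₁ < k₂) :
    angleSpeed r k₁ ψ < angleSpeed r k₂ ψ := by
  have := mul_lt_mul_of_pos_right h (anglePot_pos hr hs)
  unfold angleSpeed
  linarith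

theorem exists_abs_angleSpeed_sub_le {r : ℝ} (hr : 0 < r) {k : ℝ → ℝ}
    (hk : ContinuousOn k (Icc 0 1)) : ∃ K : ℝ, ∀ x ∈ Icc (0 : ℝ) 1, ∀ s t,
      |angleSpeed r (k x) s - angleSpeed r (k x) t| ≤ K * |s - t| := by
  obtain ⟨K, hK⟩ := exists_lipschitz_angleSpeed hr hk
  refine ⟨K, fun x hx s t => ?_⟩
  simpa [Real.dist_eq] using (hK x hx).dist_le_mul s t

/-- Sturm comparison: a larger potential turns the angle further. Only the larger potential has to
be continuous, and the potentials are compared only where the slower solution does not vanish. -/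
theorem IsAngle.lt_of_lt_continuousOn {r : ℝ} (hr : 0 < r) {k₁ k₂ ψ₁ ψ₂ : ℝ → ℝ}
    (hk : ContinuousOn k₂ (Icc 0 1)) (h₁ : IsAngle r k₁ ψ₁) (h₂ : IsAngle r k₂ ψ₂)
    (h0 : ψ₁ 0 = ψ₂ 0) (hlt : ∀ x ∈ Icc (0 : ℝ) 1, Real.sin (ψ₁ x) ≠ 0 → k₁ x < k₂ x) :
    ψ₁ 1 < ψ₂ 1 := by
  obtain ⟨K, hK⟩ := exists_abs_angleSpeed_sub_le hr hk
  obtain ⟨x, hx, hs⟩ := h₁.exists_sin_ne_zero hr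
  exact lt_of_subsolution_of_supersolution h₁ h₂ hK
    (fun x hx => angleSpeed_le hr fun hs => (hlt x hx hs).le) (fun _ _ => le_rfl) h0.le
    ⟨x, hx, Or.inl (angleSpeed_lt hr hs (hlt x hx hs))⟩

/-- Sturm comparison: a smaller potential turns the angle less. Only the smaller potential has to
be continuous, and the potentials are compared only where the faster solution does not vanish. -/
theorem IsAngle.lt_of_continuousOn_lt {r : ℝ} (hr : 0 < r) {k₁ k₂ ψ₁ ψ₂ : ℝ → ℝ}
    (hk : ContinuousOn k₁ (Icc 0 1)) (h₁ : IsAngle r k₁ ψ₁) (h₂ : IsAngle r k₂ ψ₂)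
    (h0 : ψ₁ 0 = ψ₂ 0) (hlt : ∀ x ∈ Icc (0 : ℝ) 1, Real.sin (ψ₂ x) ≠ 0 → k₁ x < k₂ x) :
    ψ₁ 1 < ψ₂ 1 := by
  obtain ⟨K, hK⟩ := exists_abs_angleSpeed_sub_le hr hk
  obtain ⟨x, hx, hs⟩ := h₂.exists_sin_ne_zero hr
  exact lt_of_subsolution_of_supersolution h₁ h₂ hK (fun _ _ => le_rfl)
    (fun x hx => angleSpeed_le hr fun hs => (hlt x hx hs).le) h0.le
    ⟨x, hx, Or.inr (angleSpeed_lt hr hs (hlt x hx hs))⟩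

/-- Uniqueness for the angle equation; the two potentials may differ where the solutions vanish. -/
theorem IsAngle.eqOn {r : ℝ} (hr : 0 < r) {k₁ k₂ ψ₁ ψ₂ : ℝ → ℝ}
    (hk : ContinuousOn k₂ (Icc 0 1)) (h₁ : IsAngle r k₁ ψ₁) (h₂ : IsAngle r k₂ ψ₂)
    (h0 : ψ₁ 0 = ψ₂ 0) (heq : ∀ x ∈ Icc (0 : ℝ) 1, Real.sin (ψ₁ x) ≠ 0 → k₁ x = k₂ x) :
    EqOn ψ₁ ψ₂ (Icc 0 1) := by
  obtain ⟨K, hK⟩ := exists_abs_angleSpeed_sub_le hr hk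
  have hl := le_of_subsolution_of_supersolution h₁ h₂ hK
    (fun x hx => angleSpeed_le hr fun hs => (heq x hx hs).le) (fun _ _ => le_rfl) h0.le
  have hg := le_of_subsolution_of_supersolution h₂ h₁ hK (fun _ _ => le_rfl)
    (fun x hx => angleSpeed_le hr fun hs => (heq x hx hs).ge) h0.ge
  exact fun x hx => le_antisymm (hl x hx) (hg x hx)

/-! ### Dependence of the angle on a parameter -/

/-- Large constant potentials turn the angle arbitrarily far: the time needed to go from `0` to `N`
is `∫₀ᴺ 1 / (angleFree + κ anglePot)`, which tends to `0` as `κ → ∞`. -/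
theorem exists_forall_le_angle {r : ℝ} (hr : 0 < r) (N : ℝ) : ∃ κ : ℝ, ∀ k ψ : ℝ → ℝ,
    IsAngle r k ψ → (∀ x ∈ Icc (0 : ℝ) 1, κ ≤ k x) → 0 ≤ ψ 0 → N ≤ ψ 1 := by
  wlog hN : 0 ≤ N generalizing N
  · obtain ⟨κ, hκ⟩ := this 0 le_rfl
    exact ⟨κ, fun k ψ h hk h0 => (not_le.1 hN).le.trans (hκ k ψ h hk h0)⟩
  have hA := (contDiff_angleFree hr).continuous
  have hB := (contDiff_anglePot hr).continuous
  have hpos : ∀ κ : ℝ, 1 ≤ κ → ∀ s, 0 < angleSpeed r κ s := fun κ hκ s => by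
    have h1 := angleFree_add_anglePot_pos hr s
    have h2 := anglePot_nonneg hr s
    unfold angleSpeed
    nlinarith
  have hcont : ∀ κ : ℝ, 1 ≤ κ → Continuous fun s => (angleSpeed r κ s)⁻¹ := fun κ hκ =>
    (hA.add (continuous_const.mul hB)).inv₀ fun s => (hpos κ hκ s).ne'
  have hlim : Tendsto (fun κ : ℝ => ∫ s in (0 : ℝ)..N, (angleSpeed r κ s)⁻¹) atTop
      (𝓝 (∫ _ in (0 : ℝ)..N, (0 : ℝ))) := by
    refine intervalIntegral.tendsto_integral_filter_of_dominated_convergence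
      (fun s => (angleSpeed r 1 s)⁻¹) ?_ ?_ ((hcont 1 le_rfl).intervalIntegrable _ _) ?_
    · filter_upwards [eventually_ge_atTop 1] with κ hκ
      exact (hcont κ hκ).aestronglyMeasurable
    · filter_upwards [eventually_ge_atTop 1] with κ hκ
      refine MeasureTheory.ae_of_all _ fun s _ => ?_
      rw [Real.norm_of_nonneg (inv_pos.2 (hpos κ hκ s)).le]
      refine inv_anti₀ (hpos 1 le_rfl s) ?_
      have h2 := anglePot_nonneg hr s
      unfold angleSpeed
      nlinarith
    · have hnull : MeasureTheory.volume (range fun n : ℤ => (n : ℝ) * Real.pi) = 0 :=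
        (countable_range _).measure_zero _
      filter_upwards [MeasureTheory.compl_mem_ae_iff.2 hnull] with s hs _
      have hs' : Real.sin s ≠ 0 := fun h => hs (by
        obtain ⟨n, hn⟩ := Real.sin_eq_zero_iff.1 h
        exact ⟨n, hn⟩)
      exact tendsto_inv_atTop_zero.comp (tendsto_atTop_add_const_left _ _
        (tendsto_id.atTop_mul_const (anglePot_pos hr hs')))
  rw [intervalIntegral.integral_zero] at hlim
  obtain ⟨κ, hκ, hκ1⟩ := ((hlim.eventually (gt_mem_nhds one_pos)).and
    (eventually_ge_atTop 1)).exists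
  refine ⟨κ, fun k ψ h hk h0 => ?_⟩
  by_contra! hlt
  set Q : ℝ → ℝ := fun t => ∫ s in (0 : ℝ)..t, (angleSpeed r κ s)⁻¹ with hQ
  have hQd : ∀ t, HasDerivAt Q (angleSpeed r κ t)⁻¹ t := fun t =>
    ((hcont κ hκ1).integral_hasStrictDerivAt 0 t).hasDerivAt
  have hQm : Monotone Q := monotone_of_hasDerivAt_nonneg hQd fun t => (inv_pos.2 (hpos κ hκ1 t)).le
  have hmono : MonotoneOn (fun x => Q (ψ x) - x) (Icc 0 1) := by
    refine monotoneOn_of_hasDerivWithinAt_nonneg (f' := fun x =>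
      (angleSpeed r κ (ψ x))⁻¹ * angleSpeed r (k x) (ψ x) - 1) (fun x hx => ?_) fun x hx => ?_
    · exact ((hQd (ψ x)).comp_hasDerivWithinAt x (h x hx)).sub (hasDerivWithinAt_id x _)
    · have h1 := angleSpeed_le (ψ := ψ x) hr fun _ => hk x hx
      rw [sub_nonneg, inv_mul_eq_div, one_le_div (hpos κ hκ1 _)]
      exact h1
  have h1 := hmono (left_mem_Icc.2 zero_le_one) (right_mem_Icc.2 zero_le_one) zero_le_one
  have h2 := hQm h0
  have h3 := hQm hlt.le
  have h4 : Q 0 = 0 := intervalIntegral.integral_same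
  have h5 : Q N < 1 := hκ
  simp only at h1
  linarith

/-- Very negative potentials bring the angle close to `0`: it stays below the segment from a point
of `(ψ₀, π)` to a small positive number, along which the potential acts with full strength. -/
theorem exists_forall_angle_lt {r : ℝ} (hr : 0 < r) {ψ₀ ε : ℝ} (hψ₀ : ψ₀ < Real.pi) (hε : 0 < ε) :
    ∃ κ : ℝ, ∀ k ψ : ℝ → ℝ,
      IsAngle r k ψ → (∀ x ∈ Icc (0 : ℝ) 1, k x ≤ κ) → ψ 0 ≤ ψ₀ → ψ 1 < ε := by
  obtain ⟨C, hC, -, -⟩ := exists_bound_lipschitz_angle hr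
  set δ := min (ε / 2) (Real.pi / 2) with hδ
  have hδ0 : 0 < δ := lt_min (by linarith) (by positivity)
  have hδε : δ < ε := (min_le_left _ _).trans_lt (by linarith)
  have hδπ : δ < Real.pi := (min_le_right _ _).trans_lt (by linarith [Real.pi_pos])
  set γ := max ψ₀ δ with hγ
  have hδγ : δ ≤ γ := le_max_right _ _
  have hγπ : γ < Real.pi := max_lt hψ₀ hδπ
  obtain ⟨t, ht, hmin⟩ := (isCompact_Icc (a := δ) (b := γ)).exists_isMinOn ⟨δ, le_rfl, hδγ⟩
    (contDiff_anglePot hr).continuous.continuousOn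
  have hm : 0 < anglePot r t := anglePot_pos hr
    (Real.sin_pos_of_pos_of_lt_pi (hδ0.trans_le ht.1) (ht.2.trans_lt hγπ)).ne'
  set m := anglePot r t
  have hCγ : 0 ≤ (C + (γ - δ) + 1) / m := by
    have := C.2
    apply div_nonneg _ hm.le
    linarith
  refine ⟨-((C + (γ - δ) + 1) / m), fun k ψ h hk h0 => ?_⟩
  suffices ψ 1 ≤ γ + (δ - γ) * 1 by linarith
  refine image_le_of_deriv_right_lt_deriv_boundary (a := 0) (b := 1)
    (B := fun x => γ + (δ - γ) * x) (B' := fun _ => δ - γ) h.continuousOn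
    (fun y hy => hasDerivWithinAt_Ici_of_Icc hy (h y (Ico_subset_Icc_self hy))) ?_ ?_ ?_
    (right_mem_Icc.2 zero_le_one)
  · rw [mul_zero, add_zero]
    exact h0.trans (le_max_left _ _)
  · intro x
    simpa using ((hasDerivAt_id x).const_mul (δ - γ)).const_add γ
  · intro x hx hxB
    have hmem : ψ x ∈ Icc δ γ := by
      rw [hxB]
      constructor <;> nlinarith [hx.1, hx.2]
    have h1 : m ≤ anglePot r (ψ x) := hmin hmem
    have h2 := hC (ψ x)
    have h3 := hk x (Ico_subset_Icc_self hx)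
    have h4 : (C + (γ - δ) + 1) / m * m = C + (γ - δ) + 1 := div_mul_cancel₀ _ hm.ne'
    have h5 : k x * anglePot r (ψ x) ≤ -((C + (γ - δ) + 1) / m) * anglePot r (ψ x) :=
      mul_le_mul_of_nonneg_right h3 (hm.le.trans h1)
    have h6 := mul_le_mul_of_nonneg_left h1 hCγ
    unfold angleSpeed
    linarith

/-- The terminal angle for the potential `lam * w - q` as a function of `lam`: it increases strictly
and continuously, from values that come arbitrarily close to `0`, to `∞`. -/
theorem exists_shooting {r : ℝ} (hr : 0 < r) {q w : ℝ → ℝ} (hq : ContinuousOn q (Icc 0 1))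
    (hw : ContinuousOn w (Icc 0 1)) (hw0 : ∀ x ∈ Icc (0 : ℝ) 1, 0 < w x) {ψ₀ : ℝ}
    (hψ₀ : ψ₀ ∈ Ico 0 Real.pi) : ∃ Ψ : ℝ → ℝ → ℝ,
      (∀ lam, Ψ lam 0 = ψ₀ ∧ IsAngle r (fun x => lam * w x - q x) (Ψ lam)) ∧
      StrictMono (fun lam => Ψ lam 1) ∧ Continuous (fun lam => Ψ lam 1) ∧
      (∀ N, ∃ lam, N ≤ Ψ lam 1) ∧ ∀ ε > 0, ∃ lam, Ψ lam 1 < ε := by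
  have hk : ∀ lam : ℝ, ContinuousOn (fun x => lam * w x - q x) (Icc 0 1) := fun lam =>
    (continuousOn_const.mul hw).sub hq
  choose Ψ hΨ0 hΨ using fun lam : ℝ => exists_isAngle hr (hk lam) ψ₀
  obtain ⟨z, hz, hmin⟩ := (isCompact_Icc (a := (0 : ℝ)) (b := 1)).exists_isMinOn ⟨0, by simp⟩ hw
  have hm := hw0 z hz
  obtain ⟨M, hM⟩ := isCompact_Icc.exists_bound_of_continuousOn hq
  obtain ⟨W, hW⟩ := isCompact_Icc.exists_bound_of_continuousOn hw
  obtain ⟨C, -, hC, -⟩ := exists_bound_lipschitz_angle hr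
  have hlow : ∀ κ : ℝ, ∃ lam : ℝ, ∀ x ∈ Icc (0 : ℝ) 1, κ ≤ lam * w x - q x := fun κ => by
    refine ⟨(|κ| + M) / w z, fun x hx => ?_⟩
    have h0 : 0 ≤ |κ| + M := by
      linarith [abs_nonneg κ, (norm_nonneg (q x)).trans (hM x hx)]
    have h1 : (|κ| + M) / w z * w z = |κ| + M := div_mul_cancel₀ _ hm.ne'
    have h2 := mul_le_mul_of_nonneg_left (show w z ≤ w x from hmin hx) (div_nonneg h0 hm.le)
    linarith [(le_abs_self (q x)).trans (hM x hx), le_abs_self κ]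
  have hhigh : ∀ κ : ℝ, ∃ lam : ℝ, ∀ x ∈ Icc (0 : ℝ) 1, lam * w x - q x ≤ κ := fun κ => by
    refine ⟨-((|κ| + M) / w z), fun x hx => ?_⟩
    have h0 : 0 ≤ |κ| + M := by
      linarith [abs_nonneg κ, (norm_nonneg (q x)).trans (hM x hx)]
    have h1 : (|κ| + M) / w z * w z = |κ| + M := div_mul_cancel₀ _ hm.ne'
    have h2 := mul_le_mul_of_nonneg_left (show w z ≤ w x from hmin hx) (div_nonneg h0 hm.le)
    linarith [(neg_abs_le (q x)), hM x hx, neg_abs_le κ, Real.norm_eq_abs (q x)]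
  refine ⟨Ψ, fun lam => ⟨hΨ0 lam, hΨ lam⟩, fun l₁ l₂ h => ?_, ?_, fun N => ?_, fun ε hε => ?_⟩
  · refine (hΨ l₁).lt_of_lt_continuousOn hr (hk l₂) (hΨ l₂) ((hΨ0 l₁).trans (hΨ0 l₂).symm)
      fun x hx _ => ?_
    have := mul_lt_mul_of_pos_right h (hw0 x hx)
    linarith
  · -- Gronwall's inequality bounds the difference of two terminal angles
    refine continuous_iff_continuousAt.2 fun l₀ => ?_
    obtain ⟨K, hK⟩ := exists_lipschitz_angleSpeed hr (hk l₀)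
    have hbd : ∀ lam, dist (Ψ lam 1) (Ψ l₀ 1) ≤
        gronwallBound 0 K (|lam - l₀| * (W * C) + 0) (1 - 0) := fun lam => by
      refine dist_le_of_approx_trajectories_ODE_of_mem (a := 0) (b := 1) (s := fun _ => univ)
        (v := fun x => angleSpeed r (l₀ * w x - q x))
        (fun x hx => (hK x (Ico_subset_Icc_self hx)).lipschitzOnWith) (hΨ lam).continuousOn
        (fun x hx => hasDerivWithinAt_Ici_of_Icc hx (hΨ lam x (Ico_subset_Icc_self hx)))
        (fun x hx => ?_) (fun _ _ => trivial) (hΨ l₀).continuousOn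
        (fun x hx => hasDerivWithinAt_Ici_of_Icc hx (hΨ l₀ x (Ico_subset_Icc_self hx)))
        (fun x hx => (dist_self _).le) (fun _ _ => trivial) ?_ 1 (right_mem_Icc.2 zero_le_one)
      · have h1 := hW x (Ico_subset_Icc_self hx)
        have h2 := hC (Ψ lam x)
        have h3 : angleSpeed r (lam * w x - q x) (Ψ lam x) -
            angleSpeed r (l₀ * w x - q x) (Ψ lam x) =
              (lam - l₀) * (w x * anglePot r (Ψ lam x)) := by
          unfold angleSpeed; ring
        rw [Real.dist_eq, h3, abs_mul, abs_mul, abs_of_nonneg (anglePot_nonneg hr _)]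
        rw [Real.norm_eq_abs] at h1
        have h4 := (abs_nonneg (w x)).trans h1
        gcongr
        exact anglePot_nonneg hr _
      · simp [hΨ0]
    have hlim : Tendsto (fun lam => gronwallBound 0 K (|lam - l₀| * (W * C) + 0) (1 - 0)) (𝓝 l₀)
        (𝓝 0) := by
      have hc : Continuous fun lam => gronwallBound 0 K (|lam - l₀| * (W * C) + 0) (1 - 0) :=
        (gronwallBound_continuous_ε 0 K (1 - 0)).comp (by fun_prop)
      have := hc.tendsto l₀
      simpa [gronwallBound_ε0_δ0] using this
    exact tendsto_iff_dist_tendsto_zero.2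
      (squeeze_zero (fun _ => dist_nonneg) hbd hlim)
  · obtain ⟨κ, hκ⟩ := exists_forall_le_angle hr N
    obtain ⟨lam, hlam⟩ := hlow κ
    exact ⟨lam, hκ _ _ (hΨ lam) hlam (by rw [hΨ0]; exact hψ₀.1)⟩
  · obtain ⟨κ, hκ⟩ := exists_forall_angle_lt hr hψ₀.2 hε
    obtain ⟨lam, hlam⟩ := hhigh κ
    exact ⟨lam, hκ _ _ (hΨ lam) hlam (hΨ0 lam).le⟩

/-! ### Counting the crossings of multiples of `π` -/

/-- The angle has slope `1` at every multiple of `π`, so it never falls back below one. -/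
theorem IsAngle.lt_of_le {r : ℝ} (hr : 0 < r) {k ψ : ℝ → ℝ} (h : IsAngle r k ψ) {n : ℤ} {a b : ℝ}
    (ha : 0 ≤ a) (hab : a < b) (hb : b ≤ 1) (hn : n * Real.pi ≤ ψ a) : n * Real.pi < ψ b := by
  have hslope : ∀ x, ψ x = n * Real.pi → angleSpeed r (k x) (ψ x) = 1 := fun x hx => by
    have hs : Real.sin (ψ x) = 0 := by rw [hx]; exact Real.sin_int_mul_pi n
    rw [angleSpeed, angleFree_of_sin_eq_zero hr hs, anglePot_of_sin_eq_zero hr hs]; ring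
  have hle : ∀ x ∈ Icc a b, -ψ x ≤ -(n * Real.pi) := by
    refine image_le_of_deriv_right_lt_deriv_boundary (f := fun x => -ψ x)
      (f' := fun x => -angleSpeed r (k x) (ψ x)) (B' := fun _ => 0)
      (h.continuousOn.neg.mono (Icc_subset_Icc ha hb)) (fun x hx => ?_) (by linarith)
      (fun x => hasDerivAt_const _ _) fun x _ hxn => ?_
    · have hx' : x ∈ Ico (0 : ℝ) 1 := ⟨ha.trans hx.1, hx.2.trans_le hb⟩
      exact (hasDerivWithinAt_Ici_of_Icc hx' (h x (Ico_subset_Icc_self hx'))).neg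
    · rw [hslope x (by linarith)]; norm_num
  have hbmem : b ∈ Icc (0 : ℝ) 1 := ⟨ha.trans hab.le, hb⟩
  refine lt_of_le_of_ne (by linarith [hle b (right_mem_Icc.2 hab.le)]) fun heq => ?_
  have hd : HasDerivWithinAt ψ 1 (Iio b) b := by
    have := h b hbmem
    rw [hslope b heq.symm] at this
    exact (this.mono (Icc_subset_Icc ha hb)).mono_of_mem_nhdsWithin
      (mem_of_superset (Ico_mem_nhdsLT hab) Ico_subset_Icc_self)
  have hslope' := (hasDerivWithinAt_iff_tendsto_slope' (by simp)).1 hd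
  obtain ⟨x, hx, hxab⟩ := ((hslope'.eventually (lt_mem_nhds one_pos)).and
    (Ico_mem_nhdsLT hab)).exists
  rw [slope_def_field] at hx
  have h1 := hle x (Ico_subset_Icc_self hxab)
  have h2 : (ψ x - ψ b) / (x - b) ≤ 0 :=
    div_nonpos_of_nonneg_of_nonpos (by linarith) (by linarith [hxab.2])
  linarith

/-- The zeros of `sin ψ` in `(0, 1)` correspond to the multiples of `π` between `ψ 0` and `ψ 1`. -/
theorem IsAngle.encard_zeros {r : ℝ} (hr : 0 < r) {k ψ : ℝ → ℝ} (h : IsAngle r k ψ)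
    (h0 : ψ 0 ∈ Ico 0 Real.pi) {n : ℕ} (h1 : ψ 1 ∈ Ioc (n * Real.pi) ((n + 1) * Real.pi)) :
    {x ∈ Ioo (0 : ℝ) 1 | Real.sin (ψ x) = 0}.encard = n := by
  have hπ := Real.pi_pos
  choose! c hc using fun x : ℝ => (Real.sin_eq_zero_iff (x := ψ x)).1
  have hbij : BijOn c {x ∈ Ioo (0 : ℝ) 1 | Real.sin (ψ x) = 0} (Icc (1 : ℤ) n) := by
    refine ⟨fun x hx => ?_, fun x hx y hy hxy => ?_, fun m hm => ?_⟩
    · have e := hc x hx.2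
      constructor
      · by_contra! hlt
        have : (c x : ℝ) ≤ 0 := by exact_mod_cast Int.lt_add_one_iff.1 hlt
        have := h.lt_of_le hr (n := c x) le_rfl hx.1.1 hx.1.2.le (by nlinarith [h0.1])
        linarith
      · by_contra! hlt
        have h2 : (n : ℝ) + 1 ≤ c x := by exact_mod_cast hlt
        have h3 := h.lt_of_le hr (n := c x) hx.1.1.le hx.1.2 le_rfl e.le
        nlinarith [h1.2]
    · have e1 := hc x hx.2
      have e2 := hc y hy.2
      rcases lt_trichotomy x y with hlt | heq | hlt
      · have := h.lt_of_le hr (n := c x) hx.1.1.le hlt hy.1.2.le e1.le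
        rw [hxy] at this; linarith
      · exact heq
      · have := h.lt_of_le hr (n := c y) hy.1.1.le hlt hx.1.2.le e2.le
        rw [← hxy] at this; linarith
    · have hm1 : (1 : ℝ) ≤ m := by exact_mod_cast hm.1
      have hm2 : (m : ℝ) ≤ n := by exact_mod_cast hm.2
      obtain ⟨x, hx, hxm⟩ := intermediate_value_Ioo zero_le_one h.continuousOn
        (show (m : ℝ) * Real.pi ∈ Ioo (ψ 0) (ψ 1) from
          ⟨by nlinarith [h0.2], by nlinarith [h1.1]⟩)
      have hs : Real.sin (ψ x) = 0 := by rw [hxm]; exact Real.sin_int_mul_pi m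
      refine ⟨x, ⟨hx, hs⟩, ?_⟩
      have := hc x hs
      rw [hxm] at this
      exact_mod_cast mul_right_cancel₀ hπ.ne' this
  rw [← hbij.injOn.encard_image, hbij.image_eq, ← Finset.coe_Icc, Set.encard_coe_eq_coe_finsetCard]
  simp

/-! ### The half-linear equation as a first-order system -/

theorem exists_primitive {g : ℝ → ℝ} (hg : ContinuousOn g (Icc 0 1)) (c : ℝ) :
    ∃ G : ℝ → ℝ, G 0 = c ∧ ∀ x ∈ Icc (0 : ℝ) 1, HasDerivWithinAt G (g x) (Icc 0 1) x := by
  have hc : Continuous (IccExtend zero_le_one ((Icc (0 : ℝ) 1).domRestrict g)) :=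
    (continuousOn_iff_continuous_domRestrict.1 hg).Icc_extend'
  refine ⟨fun x => c + ∫ t in (0 : ℝ)..x, IccExtend zero_le_one ((Icc (0 : ℝ) 1).domRestrict g) t,
    by simp, fun x hx => ?_⟩
  have h := (((hc.integral_hasStrictDerivAt 0 x).hasDerivAt).const_add c).hasDerivWithinAt
    (s := Icc (0 : ℝ) 1)
  rwa [IccExtend_of_mem _ _ hx] at h

theorem eq_of_hasDerivWithinAt_zero {f : ℝ → ℝ}
    (hf : ∀ x ∈ Icc (0 : ℝ) 1, HasDerivWithinAt f 0 (Icc 0 1) x) :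
    ∀ x ∈ Icc (0 : ℝ) 1, f x = f 0 := by
  intro x hx
  have h0 : (0 : ℝ) ∈ Icc (0 : ℝ) 1 := left_mem_Icc.2 zero_le_one
  have h1 := monotoneOn_of_hasDerivWithinAt_nonneg hf (fun _ _ => le_rfl) h0 hx hx.1
  have h2 := monotoneOn_of_hasDerivWithinAt_nonneg (f := fun x => -f x) (f' := fun _ => 0)
    (fun x hx => (hf x hx).neg.congr_deriv neg_zero) (fun _ _ => le_rfl) h0 hx hx.1
  simp only [neg_le_neg_iff] at h2
  exact le_antisymm h2 h1

/-- `y` and its flux `v` satisfy `y' = v^{(1/r)}`, `v' = N` on `[0, 1]`, where `r = p - 1`. -/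
structure IsFlow (r : ℝ) (y v N : ℝ → ℝ) : Prop where
  deriv_fst : ∀ x ∈ Icc (0 : ℝ) 1, HasDerivWithinAt y (spow r⁻¹ (v x)) (Icc 0 1) x
  deriv_snd : ∀ x ∈ Icc (0 : ℝ) 1, HasDerivWithinAt v (N x) (Icc 0 1) x

namespace IsFlow

variable {p r : ℝ} {y v N : ℝ → ℝ}

theorem continuousOn_fst (h : IsFlow r y v N) : ContinuousOn y (Icc 0 1) :=
  fun x hx => (h.deriv_fst x hx).continuousWithinAt

theorem continuousOn_snd (h : IsFlow r y v N) : ContinuousOn v (Icc 0 1) :=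
  fun x hx => (h.deriv_snd x hx).continuousWithinAt

theorem dI_eq (h : IsFlow r y v N) {x : ℝ} (hx : x ∈ Icc (0 : ℝ) 1) : dI y x = spow r⁻¹ (v x) :=
  (h.deriv_fst x hx).derivWithin (uniqueDiffOn_Icc zero_lt_one x hx)

theorem flux_eq (hp : 1 < p) (h : IsFlow (p - 1) y v N) {x : ℝ} (hx : x ∈ Icc (0 : ℝ) 1) :
    flux p y x = v x := by
  rw [flux, h.dI_eq hx, spow_spow (inv_mul_cancel₀ (by linarith))]

theorem hasDerivAt_flux (hp : 1 < p) (h : IsFlow (p - 1) y v N) {x : ℝ} (hx : x ∈ Ioo (0 : ℝ) 1) :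
    HasDerivAt (flux p y) (N x) x := by
  have hn : Icc (0 : ℝ) 1 ∈ 𝓝 x := Icc_mem_nhds hx.1 hx.2
  exact ((h.deriv_snd x (Ioo_subset_Icc_self hx)).hasDerivAt hn).congr_of_eventuallyEq
    (mem_of_superset hn fun z hz => h.flux_eq hp hz)

theorem isRegular (hp : 1 < p) (h : IsFlow (p - 1) y v N) : IsRegular p y := by
  refine ⟨?_, fun x hx => (h.hasDerivAt_flux hp hx).differentiableAt⟩
  have h1 : ContinuousOn (fun x => spow (p - 1)⁻¹ (v x)) (Icc 0 1) :=
    (continuous_spow (inv_pos.2 (by linarith))).comp_continuousOn h.continuousOn_snd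
  rw [contDiffOn_one_iff_derivWithin (uniqueDiffOn_Icc zero_lt_one)]
  exact ⟨fun x hx => (h.deriv_fst x hx).differentiableWithinAt, h1.congr fun x hx => h.dI_eq hx⟩

/-- The flux of a solution of the differential equation on `(0, 1)` is differentiable up to the
endpoints. -/
theorem of_isRegular (hp : 1 < p) (hy : IsRegular p y) (hN : ContinuousOn N (Icc 0 1))
    (h : ∀ x ∈ Ioo (0 : ℝ) 1, deriv (flux p y) x = N x) : IsFlow (p - 1) y (flux p y) N := by
  have hr : 0 < p - 1 := by linarith
  have hd : ContinuousOn (dI y) (Icc 0 1) :=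
    hy.contDiffOn.continuousOn_derivWithin (uniqueDiffOn_Icc zero_lt_one) le_rfl
  have hv : ContinuousOn (flux p y) (Icc 0 1) := (continuous_spow hr).comp_continuousOn hd
  refine ⟨fun x hx => ?_, fun x hx => ?_⟩
  · rw [flux, spow_spow (mul_inv_cancel₀ hr.ne')]
    exact (hy.contDiffOn.differentiableOn one_ne_zero x hx).hasDerivWithinAt
  · obtain ⟨G, hG0, hG⟩ := exists_primitive hN (flux p y 0)
    have heq : ∀ z ∈ Icc (0 : ℝ) 1, flux p y z = G z := by
      intro z hz
      have hsub : Icc 0 z ⊆ Icc (0 : ℝ) 1 := Icc_subset_Icc_right hz.2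
      have hsub' : Ioo 0 z ⊆ Ioo (0 : ℝ) 1 := Ioo_subset_Ioo_right hz.2
      have hint : IntervalIntegrable N MeasureTheory.volume 0 z :=
        (hN.mono hsub).intervalIntegrable_of_Icc hz.1
      have e1 := intervalIntegral.integral_eq_sub_of_hasDerivAt_of_le hz.1 (hv.mono hsub)
        (fun t ht => by
          rw [← h t (hsub' ht)]
          exact (hy.flux_differentiableAt t (hsub' ht)).hasDerivAt) hint
      have e2 := intervalIntegral.integral_eq_sub_of_hasDerivAt_of_le (f := G) hz.1
        (fun t ht => ((hG t (hsub ht)).continuousWithinAt).mono hsub)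
        (fun t ht => (hG t (Ioo_subset_Icc_self (hsub' ht))).hasDerivAt
          (Icc_mem_nhds (hsub' ht).1 (hsub' ht).2)) hint
      linarith
    exact (hG x hx).congr heq (heq x hx)

end IsFlow

/-- Every angle function comes from a solution `y = e^L sin ψ`, `v = e^{rL} cos ψ`. -/
theorem IsAngle.exists_isFlow {r : ℝ} (hr : 0 < r) {k ψ : ℝ → ℝ} (hk : ContinuousOn k (Icc 0 1))
    (h : IsAngle r k ψ) : ∃ L y v : ℝ → ℝ, IsFlow r y v (fun x => -(r * k x * spow r (y x))) ∧
      (∀ x, y x = Real.exp (L x) * Real.sin (ψ x)) ∧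
      ∀ x, v x = Real.exp (L x) ^ r * Real.cos (ψ x) := by
  have hψ := h.continuousOn
  have hc : ContinuousOn (fun x => Real.cos (ψ x)) (Icc 0 1) :=
    Real.continuous_cos.comp_continuousOn hψ
  have hs : ContinuousOn (fun x => Real.sin (ψ x)) (Icc 0 1) :=
    Real.continuous_sin.comp_continuousOn hψ
  have hρ : ContinuousOn (fun x => (Real.sin (ψ x) * spow r⁻¹ (Real.cos (ψ x)) -
      r * k x * (spow r (Real.sin (ψ x)) * Real.cos (ψ x))) / angleDen r (ψ x)) (Icc 0 1) := by
    refine ContinuousOn.div ((hs.mul ((continuous_spow (inv_pos.2 hr)).comp_continuousOn hc)).sub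
      ((continuousOn_const.mul hk).mul (((continuous_spow hr).comp_continuousOn hs).mul hc)))
      ((contDiff_angleDen r).continuous.comp_continuousOn hψ) fun x _ => (angleDen_pos hr _).ne'
  obtain ⟨L, -, hL⟩ := exists_primitive hρ 0
  refine ⟨L, fun x => Real.exp (L x) * Real.sin (ψ x), fun x => Real.exp (L x) ^ r * Real.cos (ψ x),
    ⟨fun x hx => ?_, fun x hx => ?_⟩, fun x => rfl, fun x => rfl⟩
  · have hD := (angleDen_pos hr (ψ x)).ne'
    refine ((hL x hx).exp.mul (h x hx).sin).congr_deriv ?_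
    have hcc := mul_spow_self (inv_pos.2 hr) (Real.cos (ψ x))
    have hss := mul_spow_self hr (Real.sin (ψ x))
    rw [mul_comm (Real.exp (L x) ^ r), mul_comm, mul_comm _ (Real.exp (L x) ^ r),
      spow_mul_of_pos _ (Real.rpow_pos_of_pos (Real.exp_pos _) _),
      Real.rpow_rpow_inv (Real.exp_pos _).le hr.ne', angleSpeed, angleFree, anglePot, ← hcc, ← hss]
    field_simp
    rw [angleDen]
    ring
  · have hD := (angleDen_pos hr (ψ x)).ne'
    have e : ∀ z, Real.exp (L z) ^ r = Real.exp (r * L z) := fun z => by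
      rw [← Real.exp_mul, mul_comm]
    have := (((hL x hx).const_mul r).exp.mul (h x hx).cos)
    simp only [e]
    refine this.congr_deriv ?_
    have hcc := mul_spow_self (inv_pos.2 hr) (Real.cos (ψ x))
    have hss := mul_spow_self hr (Real.sin (ψ x))
    rw [spow_mul_of_pos _ (Real.exp_pos _), e, angleSpeed, angleFree, anglePot, ← hcc, ← hss]
    field_simp
    rw [angleDen]
    ring

/-! ### Weighted polar coordinates along a solution -/

theorem exists_sin_cos_eq {X Z : ℝ} (h : X ^ 2 + Z ^ 2 = 1) :
    ∃ ψ, X = Real.sin ψ ∧ Z = Real.cos ψ := by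
  have hn : ‖(⟨Z, X⟩ : ℂ)‖ = 1 := by
    rw [← sq_eq_sq₀ (norm_nonneg _) zero_le_one, Complex.sq_norm, Complex.normSq_mk]
    linarith
  have h0 : (⟨Z, X⟩ : ℂ) ≠ 0 := fun h => by simp [h] at hn
  refine ⟨Complex.arg ⟨Z, X⟩, ?_, ?_⟩
  · rw [Complex.sin_arg, hn, div_one]
  · rw [Complex.cos_arg h0, hn, div_one]

theorem gauge_eq {r l ψ : ℝ} (hr : 0 < r) {u : ℝ × ℝ} (h1 : u.1 = Real.exp l * Real.sin ψ)
    (h2 : u.2 = Real.exp l ^ r * Real.cos ψ) : u ≠ 0 ∧ gauge r u = l := by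
  have he : 0 < Real.exp l := Real.exp_pos l
  have hu : u ≠ 0 := by
    rintro rfl
    have hs : Real.sin ψ = 0 := by simpa using h1.symm
    have hc : Real.cos ψ = 0 := by
      simpa [(Real.rpow_pos_of_pos he r).ne'] using h2.symm
    simpa [hs, hc] using Real.sin_sq_add_cos_sq ψ
  refine ⟨hu, (gaugeFun_strictAnti hr hu).injective ((gaugeFun_gauge hr hu).trans ?_)⟩
  have e1 : Real.exp l ^ r * Real.exp (-(r * l)) = 1 := by
    rw [← Real.exp_mul, ← Real.exp_add]; simp [mul_comm]
  have e2 : Real.exp l * Real.exp (-l) = 1 := by rw [← Real.exp_add]; simp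
  rw [gaugeFun, h1, h2, mul_right_comm, e2, mul_right_comm, e1, one_mul, one_mul,
    Real.sin_sq_add_cos_sq]

/-- Existence of weighted polar coordinates away from the origin. -/
theorem exists_polar {r : ℝ} (hr : 0 < r) {u : ℝ × ℝ} (hu : u ≠ 0) :
    ∃ l ψ, u.1 = Real.exp l * Real.sin ψ ∧ u.2 = Real.exp l ^ r * Real.cos ψ := by
  obtain ⟨ψ, h1, h2⟩ := exists_sin_cos_eq (gaugeFun_gauge hr hu)
  refine ⟨gauge r u, ψ, ?_, ?_⟩
  · rw [← h1, mul_comm, mul_assoc, ← Real.exp_add]; simp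
  · rw [← h2, ← Real.exp_mul, mul_comm, mul_assoc, ← Real.exp_add]; simp [mul_comm]

/-- Along a solution that never vanishes together with its flux the weighted polar angle can be
chosen differentiable, starting from any admissible initial angle. -/
theorem IsFlow.exists_polar {r : ℝ} (hr : 0 < r) {y v N : ℝ → ℝ} (h : IsFlow r y v N)
    (hN : ContinuousOn N (Icc 0 1)) (hne : ∀ x ∈ Icc (0 : ℝ) 1, (y x, v x) ≠ 0) {l ψ₀ : ℝ}
    (hy0 : y 0 = Real.exp l * Real.sin ψ₀) (hv0 : v 0 = Real.exp l ^ r * Real.cos ψ₀) :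
    ∃ L ψ : ℝ → ℝ, ψ 0 = ψ₀ ∧ ∀ x ∈ Icc (0 : ℝ) 1,
      y x = Real.exp (L x) * Real.sin (ψ x) ∧ v x = Real.exp (L x) ^ r * Real.cos (ψ x) ∧
      HasDerivWithinAt ψ ((r * |Real.cos (ψ x)| ^ (r⁻¹ + 1) -
        N x * (Real.exp (L x) ^ r)⁻¹ * Real.sin (ψ x)) / angleDen r (ψ x)) (Icc 0 1) x := by
  have h0mem : (0 : ℝ) ∈ Icc (0 : ℝ) 1 := left_mem_Icc.2 zero_le_one
  set L : ℝ → ℝ := fun x => gauge r (y x, v x) with hLdef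
  have hL : ∀ x ∈ Icc (0 : ℝ) 1, DifferentiableWithinAt ℝ L (Icc 0 1) x := fun x hx =>
    DifferentiableAt.comp_differentiableWithinAt (g := gauge r) (f := fun x => (y x, v x)) x
      (differentiableAt_gauge hr (hne x hx))
      ((h.deriv_fst x hx).differentiableWithinAt.prodMk (h.deriv_snd x hx).differentiableWithinAt)
  set X : ℝ → ℝ := fun x => y x * Real.exp (-L x) with hX
  set Z : ℝ → ℝ := fun x => v x * Real.exp (-(r * L x)) with hZ
  have hXZ : ∀ x ∈ Icc (0 : ℝ) 1, X x ^ 2 + Z x ^ 2 = 1 := fun x hx => gaugeFun_gauge hr (hne x hx)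
  have hyX : ∀ x, y x = Real.exp (L x) * X x := fun x => by
    rw [hX]; simp only; rw [mul_comm, mul_assoc, ← Real.exp_add]; simp
  have hvZ : ∀ x, v x = Real.exp (L x) ^ r * Z x := fun x => by
    rw [hZ]; simp only; rw [mul_comm, mul_assoc, ← Real.exp_mul, ← Real.exp_add]; simp [mul_comm]
  have hLc : ContinuousOn L (Icc 0 1) := fun x hx => (hL x hx).continuousWithinAt
  have hXc : ContinuousOn X (Icc 0 1) :=
    h.continuousOn_fst.mul (Real.continuous_exp.comp_continuousOn hLc.neg)
  have hZc : ContinuousOn Z (Icc 0 1) := h.continuousOn_snd.mul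
    (Real.continuous_exp.comp_continuousOn (continuousOn_const.mul hLc).neg)
  have hDpos : ∀ x ∈ Icc (0 : ℝ) 1, r * Z x ^ 2 + X x ^ 2 ≠ 0 := fun x hx => by
    obtain ⟨t, h1, h2⟩ := exists_sin_cos_eq (hXZ x hx)
    rw [h1, h2]
    exact (angleDen_pos hr t).ne'
  set g : ℝ → ℝ := fun x => (r * (Z x * spow r⁻¹ (Z x)) -
    N x * Real.exp (-(r * L x)) * X x) / (r * Z x ^ 2 + X x ^ 2) with hg
  have hgc : ContinuousOn g (Icc 0 1) := by
    refine ContinuousOn.div ((continuousOn_const.mul (hZc.mul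
      ((continuous_spow (inv_pos.2 hr)).comp_continuousOn hZc))).sub
        ((hN.mul (Real.continuous_exp.comp_continuousOn (continuousOn_const.mul hLc).neg)).mul hXc))
      ((continuousOn_const.mul (hZc.pow 2)).add (hXc.pow 2)) hDpos
  -- `(X, Z)` moves on the unit circle with angular speed `g`
  have hXd : ∀ x ∈ Icc (0 : ℝ) 1, HasDerivWithinAt X (g x * Z x) (Icc 0 1) x ∧
      HasDerivWithinAt Z (-(g x * X x)) (Icc 0 1) x := by
    intro x hx
    obtain ⟨m, hm⟩ : ∃ m, HasDerivWithinAt L m (Icc 0 1) x := ⟨_, (hL x hx).hasDerivWithinAt⟩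
    have hκ : spow r⁻¹ (v x) * Real.exp (-L x) = spow r⁻¹ (Z x) := by
      rw [hvZ, spow_mul_of_pos _ (Real.rpow_pos_of_pos (Real.exp_pos _) _),
        Real.rpow_rpow_inv (Real.exp_pos _).le hr.ne', mul_right_comm, ← Real.exp_add]
      simp
    have d1 : HasDerivWithinAt X (spow r⁻¹ (Z x) - m * X x) (Icc 0 1) x := by
      refine ((h.deriv_fst x hx).mul hm.neg.exp).congr_deriv ?_
      rw [← hκ, hX]
      simp only [Pi.neg_apply]
      ring
    have d2 : HasDerivWithinAt Z (N x * Real.exp (-(r * L x)) - r * m * Z x) (Icc 0 1) x := by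
      refine ((h.deriv_snd x hx).mul (hm.const_mul r).neg.exp).congr_deriv ?_
      rw [hZ]
      simp only [Pi.neg_apply]
      ring
    have d3 : X x * (spow r⁻¹ (Z x) - m * X x) +
        Z x * (N x * Real.exp (-(r * L x)) - r * m * Z x) = 0 := by
      have e1 := (d1.pow 2).add (d2.pow 2)
      have e2 : HasDerivWithinAt (X ^ 2 + Z ^ 2) 0 (Icc 0 1) x :=
        (hasDerivWithinAt_const x _ (1 : ℝ)).congr (fun z hz => hXZ z hz) (hXZ x hx)
      have e3 := (uniqueDiffOn_Icc zero_lt_one x hx).eq_deriv _ e1 e2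
      simp only [Nat.cast_ofNat, Nat.add_one_sub_one, pow_one] at e3
      linarith
    have hD := hDpos x hx
    have hone := hXZ x hx
    set s := spow r⁻¹ (Z x)
    set n := N x * Real.exp (-(r * L x))
    have hgx : g x = (s - m * X x) * Z x - (n - r * m * Z x) * X x := by
      rw [hg]
      simp only
      rw [div_eq_iff hD]
      linear_combination (r * Z x * s - n * X x) * (-hone) +
        (r * Z x * X x - X x * Z x) * d3
    refine ⟨d1.congr_deriv ?_, d2.congr_deriv ?_⟩
    · rw [hgx]; linear_combination (X x) * d3 - (s - m * X x) * hone
    · rw [hgx]; linear_combination (Z x) * d3 - (n - r * m * Z x) * hone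
  obtain ⟨ψ, hψ0, hψ⟩ := exists_primitive hgc ψ₀
  have hg0 := (gauge_eq (u := (y 0, v 0)) hr hy0 hv0).2
  have hX0 : X 0 = Real.sin ψ₀ := by
    have := hyX 0
    rw [hy0, hLdef] at this
    simp only at this
    rw [hg0] at this
    exact (mul_left_cancel₀ (Real.exp_pos l).ne' this).symm
  have hZ0 : Z 0 = Real.cos ψ₀ := by
    have := hvZ 0
    rw [hv0, hLdef] at this
    simp only at this
    rw [hg0] at this
    exact (mul_left_cancel₀ (Real.rpow_pos_of_pos (Real.exp_pos l) r).ne' this).symm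
  have hconst : ∀ x ∈ Icc (0 : ℝ) 1, X x * Real.sin (ψ x) + Z x * Real.cos (ψ x) = 1 := by
    have key := eq_of_hasDerivWithinAt_zero
      (f := fun x => X x * Real.sin (ψ x) + Z x * Real.cos (ψ x)) fun x hx =>
        (((hXd x hx).1.mul (hψ x hx).sin).add ((hXd x hx).2.mul (hψ x hx).cos)).congr_deriv
          (by ring)
    intro x hx
    refine (key x hx).trans ?_
    simp only [hX0, hZ0, hψ0]
    have := Real.sin_sq_add_cos_sq ψ₀
    linarith
  refine ⟨L, ψ, hψ0, fun x hx => ?_⟩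
  have e1 := hconst x hx
  have e2 := hXZ x hx
  have e3 := Real.sin_sq_add_cos_sq (ψ x)
  have hsum : (X x - Real.sin (ψ x)) ^ 2 + (Z x - Real.cos (ψ x)) ^ 2 = 0 := by
    linear_combination e2 + e3 - 2 * e1
  have hXs : X x = Real.sin (ψ x) := by
    have : (X x - Real.sin (ψ x)) ^ 2 = 0 := by
      nlinarith [sq_nonneg (X x - Real.sin (ψ x)), sq_nonneg (Z x - Real.cos (ψ x))]
    exact sub_eq_zero.1 (pow_eq_zero_iff two_ne_zero |>.1 this)
  have hZs : Z x = Real.cos (ψ x) := by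
    rw [hXs] at hsum
    have : (Z x - Real.cos (ψ x)) ^ 2 = 0 := by linarith
    exact sub_eq_zero.1 (pow_eq_zero_iff two_ne_zero |>.1 this)
  refine ⟨by rw [← hXs]; exact hyX x, by rw [← hZs]; exact hvZ x, (hψ x hx).congr_deriv ?_⟩
  rw [hg]
  simp only
  rw [hXs, hZs, mul_spow_self (inv_pos.2 hr), angleDen, ← Real.exp_mul, ← Real.exp_neg,
    mul_comm (L x) r]

/-! ### Boundary conditions as lines of directions -/

/-- The angle `ψ` satisfies the boundary condition with coefficients `(c, s)`, that is,
`c y = s y'` for `y = e^L sin ψ`, `y' = e^L (cos ψ)^{(1/r)}`. -/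
def IsBoundaryAngle (r c s ψ : ℝ) : Prop := c * Real.sin ψ = s * spow r⁻¹ (Real.cos ψ)

theorem isBoundaryAngle_add_int_mul_pi {r c s ψ : ℝ} (n : ℤ) :
    IsBoundaryAngle r c s (ψ + n * Real.pi) ↔ IsBoundaryAngle r c s ψ := by
  have hn : ((-1 : ℝ)) ^ n = 1 ∨ ((-1 : ℝ)) ^ n = -1 := by
    rcases Int.even_or_odd n with h | h
    · exact Or.inl h.neg_one_zpow
    · exact Or.inr h.neg_one_zpow
  unfold IsBoundaryAngle
  rw [Real.sin_add_int_mul_pi, Real.cos_add_int_mul_pi]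
  rcases hn with h | h
  · simp [h]
  · rw [h, neg_one_mul, neg_one_mul, spow_neg, mul_neg, mul_neg, neg_inj]

/-- A nondegenerate boundary condition determines the angle modulo `π`. -/
theorem sin_sub_eq_zero_of_isBoundaryAngle {r c s : ℝ} (hr : 0 < r) (hcs : ¬(c = 0 ∧ s = 0))
    {ψ₁ ψ₂ : ℝ} (h₁ : IsBoundaryAngle r c s ψ₁) (h₂ : IsBoundaryAngle r c s ψ₂) :
    Real.sin (ψ₁ - ψ₂) = 0 := by
  have hi : 0 < r⁻¹ := inv_pos.2 hr
  have hdet : Real.sin ψ₁ * spow r⁻¹ (Real.cos ψ₂) = Real.sin ψ₂ * spow r⁻¹ (Real.cos ψ₁) := by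
    unfold IsBoundaryAngle at h₁ h₂
    by_cases hc : c = 0
    · have hs : s ≠ 0 := fun hs => hcs ⟨hc, hs⟩
      subst hc
      have e1 : spow r⁻¹ (Real.cos ψ₁) = 0 := by simpa [hs] using h₁.symm
      have e2 : spow r⁻¹ (Real.cos ψ₂) = 0 := by simpa [hs] using h₂.symm
      rw [e1, e2, mul_zero, mul_zero]
    · refine mul_left_cancel₀ hc ?_
      linear_combination spow r⁻¹ (Real.cos ψ₂) * h₁ - spow r⁻¹ (Real.cos ψ₁) * h₂
  have habs : |Real.sin ψ₁| * |Real.cos ψ₂| ^ r⁻¹ = |Real.sin ψ₂| * |Real.cos ψ₁| ^ r⁻¹ := by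
    rw [← abs_spow hi, ← abs_spow hi, ← abs_mul, ← abs_mul, hdet]
  -- a strictly smaller `|sin|` goes with a strictly larger `|cos|`
  have key : ∀ a b : ℝ, |Real.sin a| * |Real.cos b| ^ r⁻¹ = |Real.sin b| * |Real.cos a| ^ r⁻¹ →
      ¬ |Real.sin a| < |Real.sin b| := by
    intro a b hab hlt
    have e1 := Real.sin_sq_add_cos_sq a
    have e2 := Real.sin_sq_add_cos_sq b
    have h1 := sq_lt_sq.2 hlt
    have h2 : |Real.cos b| < |Real.cos a| := sq_lt_sq.1 (by linarith)
    have h3 : |Real.cos b| ^ r⁻¹ < |Real.cos a| ^ r⁻¹ := Real.rpow_lt_rpow (abs_nonneg _) h2 hi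
    have h4 : 0 ≤ |Real.cos b| ^ r⁻¹ := Real.rpow_nonneg (abs_nonneg _) _
    have h5 := abs_nonneg (Real.sin a)
    nlinarith
  have hsin : |Real.sin ψ₁| = |Real.sin ψ₂| :=
    le_antisymm (not_lt.1 (key ψ₂ ψ₁ habs.symm)) (not_lt.1 (key ψ₁ ψ₂ habs))
  have hcos : |Real.cos ψ₁| = |Real.cos ψ₂| := by
    have e1 := Real.sin_sq_add_cos_sq ψ₁
    have e2 := Real.sin_sq_add_cos_sq ψ₂
    have := sq_eq_sq_iff_abs_eq_abs _ _ |>.2 hsin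
    exact sq_eq_sq_iff_abs_eq_abs _ _ |>.1 (by linarith)
  rw [Real.sin_sub]
  by_cases h0 : Real.cos ψ₂ = 0
  · have h0' : Real.cos ψ₁ = 0 := by rw [h0, abs_zero, abs_eq_zero] at hcos; exact hcos
    rw [h0, h0']; ring
  have hκ : spow r⁻¹ (Real.cos ψ₂) ≠ 0 := fun h => h0 ((spow_eq_zero hi).1 h)
  rcases abs_eq_abs.1 hcos with hc | hc
  · rw [hc] at hdet ⊢
    rw [mul_right_cancel₀ hκ hdet]; ring
  · rw [hc, spow_neg, mul_neg, ← neg_mul] at hdet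
    rw [hc, mul_right_cancel₀ hκ hdet]; ring

theorem exists_isBoundaryAngle_iff {r c s : ℝ} (hr : 0 < r) (hcs : ¬(c = 0 ∧ s = 0)) :
    ∃ ψ₀ ∈ Ico 0 Real.pi, ∀ ψ, IsBoundaryAngle r c s ψ ↔ ∃ n : ℤ, ψ = ψ₀ + n * Real.pi := by
  have hu : (s, spow r c) ≠ 0 := fun h => by
    rw [Prod.mk_eq_zero, spow_eq_zero hr] at h
    exact hcs h.symm
  obtain ⟨l, φ, h1, h2⟩ := exists_polar hr hu
  simp only at h1 h2
  have hφ : IsBoundaryAngle r c s φ := by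
    have : c = Real.exp l * spow r⁻¹ (Real.cos φ) := by
      rw [← spow_spow (mul_inv_cancel₀ hr.ne') c, h2,
        spow_mul_of_pos _ (Real.rpow_pos_of_pos (Real.exp_pos _) _),
        Real.rpow_rpow_inv (Real.exp_pos _).le hr.ne']
    rw [IsBoundaryAngle, this, h1]; ring
  obtain ⟨m, hm⟩ : ∃ m : ℤ, toIcoMod Real.pi_pos 0 φ = φ + m * Real.pi :=
    ⟨-toIcoDiv Real.pi_pos 0 φ, by rw [toIcoMod, zsmul_eq_mul]; push_cast; ring⟩
  have hψ₀ : IsBoundaryAngle r c s (toIcoMod Real.pi_pos 0 φ) := by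
    rw [hm]; exact (isBoundaryAngle_add_int_mul_pi m).2 hφ
  refine ⟨toIcoMod Real.pi_pos 0 φ, by simpa using toIcoMod_mem_Ico Real.pi_pos 0 φ,
    fun ψ => ⟨fun h => ?_, ?_⟩⟩
  · obtain ⟨n, hn⟩ := Real.sin_eq_zero_iff.1 (sin_sub_eq_zero_of_isBoundaryAngle hr hcs h hψ₀)
    exact ⟨n, by linarith⟩
  · rintro ⟨n, rfl⟩
    exact (isBoundaryAngle_add_int_mul_pi n).2 hψ₀

/-! ### Nontrivial solutions have simple zeros -/

theorem oddPos_zero {f : ℝ → ℝ} (hc : Continuous f) (ho : ∀ s, 0 < s → f (-s) = -f s) :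
    f 0 = 0 := by
  have h1 : Tendsto f (𝓝[>] 0) (𝓝 (f 0)) := (hc.tendsto 0).mono_left nhdsWithin_le_nhds
  have h2 : Tendsto (fun s => f (-s)) (𝓝[>] 0) (𝓝 (f 0)) := by
    have : Tendsto (fun s => f (-s)) (𝓝 0) (𝓝 (f (-0))) := (hc.comp continuous_neg).tendsto 0
    rw [neg_zero] at this
    exact this.mono_left nhdsWithin_le_nhds
  have h3 := tendsto_nhds_unique h2
    (h1.neg.congr' (eventually_mem_nhdsWithin.mono fun s hs => (ho s hs).symm))
  linarith

theorem primitive_nonneg {f : ℝ → ℝ} (hc : Continuous f) (hp : ∀ s, 0 < s → 0 < f s)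
    (ho : ∀ s, 0 < s → f (-s) = -f s) (s : ℝ) : 0 ≤ ∫ t in (0 : ℝ)..s, f t := by
  have h0 := oddPos_zero hc ho
  rcases le_total 0 s with hs | hs
  · refine intervalIntegral.integral_nonneg hs fun t ht => ?_
    rcases ht.1.eq_or_lt with h | h
    · rw [← h, h0]
    · exact (hp t h).le
  · rw [intervalIntegral.integral_symm, ← intervalIntegral.integral_neg]
    refine intervalIntegral.integral_nonneg hs fun t ht => ?_
    rcases ht.2.eq_or_lt with h | h
    · rw [h, h0, neg_zero]
    · have := ho (-t) (by linarith)
      rw [neg_neg] at this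
      rw [this, neg_neg]
      exact (hp (-t) (by linarith)).le

/-- A nonnegative function controlling its own derivative vanishes identically if it has a zero:
`E e^{Cx}` is nondecreasing and `E e^{-Cx}` is nonincreasing. -/
theorem eq_zero_of_abs_deriv_le {E E' : ℝ → ℝ} {C x₀ : ℝ}
    (hE : ∀ x ∈ Icc (0 : ℝ) 1, HasDerivWithinAt E (E' x) (Icc 0 1) x)
    (hE0 : ∀ x ∈ Icc (0 : ℝ) 1, 0 ≤ E x) (hC : ∀ x ∈ Icc (0 : ℝ) 1, |E' x| ≤ C * E x)
    (hx₀ : x₀ ∈ Icc (0 : ℝ) 1) (h0 : E x₀ = 0) : ∀ x ∈ Icc (0 : ℝ) 1, E x = 0 := by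
  have hexp : ∀ c x : ℝ, HasDerivWithinAt (fun x => Real.exp (c * x)) (Real.exp (c * x) * c)
      (Icc 0 1) x := fun c x => by
    simpa using (((hasDerivAt_id x).const_mul c).exp).hasDerivWithinAt (s := Icc (0 : ℝ) 1)
  have hup : MonotoneOn (fun x => E x * Real.exp (C * x)) (Icc 0 1) := by
    refine monotoneOn_of_hasDerivWithinAt_nonneg
      (fun x hx => (hE x hx).mul (hexp C x)) fun x hx => ?_
    have h1 := neg_abs_le (E' x)
    have h2 := hC x hx
    have h3 : 0 ≤ E' x + C * E x := by linarith
    have := mul_nonneg h3 (Real.exp_pos (C * x)).le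
    linarith
  have hdown : MonotoneOn (fun x => -(E x * Real.exp (-C * x))) (Icc 0 1) := by
    refine monotoneOn_of_hasDerivWithinAt_nonneg
      (fun x hx => ((hE x hx).mul (hexp (-C) x)).neg) fun x hx => ?_
    have h1 := le_abs_self (E' x)
    have h2 := hC x hx
    have h3 : 0 ≤ C * E x - E' x := by linarith
    have := mul_nonneg h3 (Real.exp_pos (-C * x)).le
    linarith
  intro x hx
  refine le_antisymm ?_ (hE0 x hx)
  rcases le_total x x₀ with h | h
  · have := hup hx hx₀ h
    simp only [h0, zero_mul] at this
    exact nonpos_of_mul_nonpos_left this (Real.exp_pos _)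
  · have := hdown hx₀ hx h
    simp only [h0, zero_mul, neg_zero] at this
    exact nonpos_of_mul_nonpos_left (neg_nonneg.1 this) (Real.exp_pos _)

theorem rpow_mul_rpow_le {r a b : ℝ} (hr : 0 < r) (ha : 0 ≤ a) (hb : 0 ≤ b) :
    a * b ^ r ≤ a ^ (r + 1) + b ^ (r + 1) := by
  have hadd : ∀ c : ℝ, 0 ≤ c → c ^ (r + 1) = c * c ^ r := fun c hc => by
    rw [Real.rpow_add_one' hc (by linarith), mul_comm]
  have h1 := Real.rpow_nonneg ha (r + 1)
  have h2 := Real.rpow_nonneg hb (r + 1)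
  rcases le_total a b with h | h
  · have := mul_le_mul_of_nonneg_right h (Real.rpow_nonneg hb r)
    rw [hadd b hb] at *
    linarith
  · have := mul_le_mul_of_nonneg_left (Real.rpow_le_rpow hb h hr.le) ha
    rw [hadd a ha] at *
    linarith

/-- If a solution vanishes together with its flux at one point, it is trivial. The energy
`|y'|^p / p + w F(y) + |y|^p / p` with `F = ∫ f` controls its own derivative whatever the growth of
`f` at `0` is, because `w` is continuously differentiable. -/
theorem IsFlow.eq_zero {r : ℝ} (hr : 0 < r) {q w f y v : ℝ → ℝ} (hq : ContinuousOn q (Icc 0 1))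
    (hw : ContDiffOn ℝ 1 w (Icc 0 1)) (hw0 : ∀ x ∈ Icc (0 : ℝ) 1, 0 < w x) (hf : Continuous f)
    (hfp : ∀ s, 0 < s → 0 < f s) (hfo : ∀ s, 0 < s → f (-s) = -f s)
    (h : IsFlow r y v fun x => r * (q x * spow r (y x) - w x * f (y x))) {x₀ : ℝ}
    (hx₀ : x₀ ∈ Icc (0 : ℝ) 1) (hy : y x₀ = 0) (hv : v x₀ = 0) :
    ∀ x ∈ Icc (0 : ℝ) 1, y x = 0 := by
  set F : ℝ → ℝ := fun s => ∫ t in (0 : ℝ)..s, f t with hF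
  have hFd : ∀ s, HasDerivAt F (f s) s := fun s => (hf.integral_hasStrictDerivAt 0 s).hasDerivAt
  have hF0 : ∀ s, 0 ≤ F s := primitive_nonneg hf hfp hfo
  have hwd : ∀ x ∈ Icc (0 : ℝ) 1, HasDerivWithinAt w (derivWithin w (Icc 0 1) x) (Icc 0 1) x :=
    fun x hx => (hw.differentiableOn one_ne_zero x hx).hasDerivWithinAt
  obtain ⟨Q, hQ⟩ := isCompact_Icc.exists_bound_of_continuousOn hq
  obtain ⟨W, hW⟩ := isCompact_Icc.exists_bound_of_continuousOn
    (hw.continuousOn_derivWithin (uniqueDiffOn_Icc zero_lt_one) le_rfl)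
  obtain ⟨z, hz, hmin⟩ := (isCompact_Icc (a := (0 : ℝ)) (b := 1)).exists_isMinOn ⟨0, by simp⟩
    hw.continuousOn
  have hm := hw0 z hz
  have hW0 : 0 ≤ W := (norm_nonneg _).trans (hW z hz)
  have hQ0 : 0 ≤ Q := (norm_nonneg _).trans (hQ z hz)
  set E : ℝ → ℝ := fun x => |v x| ^ (r⁻¹ + 1) / (r + 1) + w x * F (y x) + |y x| ^ (r + 1) / (r + 1)
    with hE
  have hEd : ∀ x ∈ Icc (0 : ℝ) 1, HasDerivWithinAt E
      ((q x + 1) * (spow r⁻¹ (v x) * spow r (y x)) + derivWithin w (Icc 0 1) x * F (y x))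
      (Icc 0 1) x := by
    intro x hx
    have d1 := ((hasDerivAt_abs_rpow_add_one (inv_pos.2 hr) (v x)).comp_hasDerivWithinAt x
      (h.deriv_snd x hx)).div_const (r + 1)
    have d2 := (hwd x hx).mul ((hFd (y x)).comp_hasDerivWithinAt x (h.deriv_fst x hx))
    have d3 := ((hasDerivAt_abs_rpow_add_one hr (y x)).comp_hasDerivWithinAt x
      (h.deriv_fst x hx)).div_const (r + 1)
    refine ((d1.add d2).add d3).congr_deriv ?_
    simp only [Function.comp_apply]
    field_simp
    ring
  have hle : ∀ x, 0 ≤ w x → |v x| ^ (r⁻¹ + 1) + |y x| ^ (r + 1) ≤ (r + 1) * E x := fun x hx => by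
    have h1 := mul_nonneg hx (hF0 (y x))
    have h2 : (r + 1) * E x = |v x| ^ (r⁻¹ + 1) + |y x| ^ (r + 1) + (r + 1) * (w x * F (y x)) := by
      rw [hE]
      field_simp
      ring
    rw [h2]
    have : 0 ≤ (r + 1) * (w x * F (y x)) := by positivity
    linarith
  have hle' : ∀ x, w x * F (y x) ≤ E x := fun x => by
    have : 0 ≤ |v x| ^ (r⁻¹ + 1) / (r + 1) := by positivity
    have : 0 ≤ |y x| ^ (r + 1) / (r + 1) := by positivity
    simp only [hE]
    linarith
  have hE0 : ∀ x ∈ Icc (0 : ℝ) 1, 0 ≤ E x := fun x hx =>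
    (mul_nonneg (hw0 x hx).le (hF0 _)).trans (hle' x)
  have hzero := eq_zero_of_abs_deriv_le (C := (Q + 1) * (r + 1) + W / w z) hEd hE0 (fun x hx => ?_)
    hx₀ (by simp [hE, hy, hv, hF, Real.zero_rpow (by positivity : r⁻¹ + 1 ≠ 0),
      Real.zero_rpow (by positivity : r + 1 ≠ 0)])
  · intro x hx
    have h1 := hle x (hw0 x hx).le
    rw [hzero x hx, mul_zero] at h1
    have h2 : 0 ≤ |v x| ^ (r⁻¹ + 1) := by positivity
    have h3 : 0 ≤ |y x| ^ (r + 1) := by positivity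
    have h4 : |y x| ^ (r + 1) = 0 := by linarith
    rwa [Real.rpow_eq_zero (abs_nonneg _) (by positivity), abs_eq_zero] at h4
  · have hκ : |spow r⁻¹ (v x) * spow r (y x)| ≤ (r + 1) * E x := by
      rw [abs_mul, abs_spow (inv_pos.2 hr), abs_spow hr]
      refine (rpow_mul_rpow_le hr (Real.rpow_nonneg (abs_nonneg _) _) (abs_nonneg _)).trans
        (le_trans (le_of_eq ?_) (hle x (hw0 x hx).le))
      rw [← Real.rpow_mul (abs_nonneg _), mul_add, inv_mul_cancel₀ hr.ne', mul_one, add_comm 1]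
    have hq1 : |q x + 1| ≤ Q + 1 := (abs_add_le _ _).trans (by simpa using hQ x hx)
    have hF1 : F (y x) ≤ E x / w z := by
      rw [le_div_iff₀ hm, mul_comm]
      exact (mul_le_mul_of_nonneg_right (show w z ≤ w x from hmin hx) (hF0 _)).trans (hle' x)
    calc |(q x + 1) * (spow r⁻¹ (v x) * spow r (y x)) + derivWithin w (Icc 0 1) x * F (y x)|
        ≤ |q x + 1| * |spow r⁻¹ (v x) * spow r (y x)| + |derivWithin w (Icc 0 1) x| * F (y x) := by
          refine (abs_add_le _ _).trans ?_
          rw [abs_mul, abs_mul (derivWithin _ _ _), abs_of_nonneg (hF0 (y x))]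
      _ ≤ (Q + 1) * ((r + 1) * E x) + W * (E x / w z) := by
          have := hW x hx
          rw [Real.norm_eq_abs] at this
          have := hF0 (y x)
          gcongr
      _ = ((Q + 1) * (r + 1) + W / w z) * E x := by ring

/-! ### The angle of a solution -/

/-- The angle of a nontrivial solution of the nonlinear problem is an angle function for the
potential `w f(|y|) / |y|^{p-1} - q`. Where `y` vanishes the quotient has a junk value, which is
harmless as the potential does not enter the angular speed there. -/
theorem IsSolution.exists_isAngle {p : ℝ} (hp : 1 < p) {q w f y : ℝ → ℝ} {α β : ℝ}
    (hq : ContinuousOn q (Icc 0 1)) (hw : ContDiffOn ℝ 1 w (Icc 0 1))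
    (hw0 : ∀ x ∈ Icc (0 : ℝ) 1, 0 < w x) (hf : Continuous f) (hfp : ∀ s, 0 < s → 0 < f s)
    (hfo : ∀ s, 0 < s → f (-s) = -f s) (hy : IsSolution p q w f α β y) (hne : NonzeroFun y)
    {ψ₀ : ℝ} (hψ₀ : ∀ ψ, IsBoundaryAngle (p - 1) (deriv (sinp p) α) (sinp p α) ψ →
      ∃ n : ℤ, ψ = ψ₀ + n * Real.pi) :
    ∃ ψ : ℝ → ℝ, ψ 0 = ψ₀ ∧
      IsBoundaryAngle (p - 1) (deriv (sinp p) β) (sinp p β) (ψ 1) ∧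
      IsAngle (p - 1) (fun x => w x * (f |y x| / |y x| ^ (p - 1)) - q x) ψ ∧
      ∀ x ∈ Icc (0 : ℝ) 1, y x = 0 ↔ Real.sin (ψ x) = 0 := by
  set r := p - 1 with hrdef
  have hr : 0 < r := by rw [hrdef]; linarith
  have hi : 0 < r⁻¹ := inv_pos.2 hr
  have h0mem : (0 : ℝ) ∈ Icc (0 : ℝ) 1 := left_mem_Icc.2 zero_le_one
  have h1mem : (1 : ℝ) ∈ Icc (0 : ℝ) 1 := right_mem_Icc.2 zero_le_one
  set v := flux p y with hv
  have hyc : ContinuousOn y (Icc 0 1) := hy.regular.contDiffOn.continuousOn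
  have hNc : ContinuousOn (fun x => r * (q x * spow r (y x) - w x * f (y x))) (Icc 0 1) :=
    continuousOn_const.mul ((hq.mul ((continuous_spow hr).comp_continuousOn hyc)).sub
      (hw.continuousOn.mul (hf.comp_continuousOn hyc)))
  have hfl : IsFlow r y v (fun x => r * (q x * spow r (y x) - w x * f (y x))) :=
    IsFlow.of_isRegular hp hy.regular hNc fun x hx => by
      have := hy.equation x hx
      rw [← hrdef] at this
      linarith
  have hnz : ∀ x ∈ Icc (0 : ℝ) 1, (y x, v x) ≠ 0 := by
    intro x hx h
    rw [Prod.mk_eq_zero] at h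
    obtain ⟨z, hz, hyz⟩ := hne
    exact hyz (hfl.eq_zero hr hq hw hw0 hf hfp hfo hx h.1 h.2 z hz)
  -- the boundary conditions are homogeneous and odd, so they only involve the angle
  have hbdry : ∀ {c s t l ψ ε : ℝ}, t ∈ Icc (0 : ℝ) 1 → (ε = 1 ∨ ε = -1) →
      ε * y t = Real.exp l * Real.sin ψ → ε * v t = Real.exp l ^ r * Real.cos ψ →
      c * y t - s * dI y t = 0 → IsBoundaryAngle r c s ψ := by
    intro c s t l ψ ε ht hε h1 h2 h
    rw [hfl.dI_eq ht] at h
    have e1 : spow r⁻¹ (ε * v t) = Real.exp l * spow r⁻¹ (Real.cos ψ) := by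
      rw [h2, spow_mul_of_pos _ (Real.rpow_pos_of_pos (Real.exp_pos _) _),
        Real.rpow_rpow_inv (Real.exp_pos _).le hr.ne']
    have e2 : spow r⁻¹ (ε * v t) = ε * spow r⁻¹ (v t) := by
      rcases hε with rfl | rfl
      · rw [one_mul, one_mul]
      · rw [neg_one_mul, neg_one_mul, spow_neg]
    refine mul_left_cancel₀ (Real.exp_pos l).ne' ?_
    linear_combination (-c) * h1 - s * (e1.symm.trans e2) + ε * h
  obtain ⟨l, φ, hl1, hl2⟩ := exists_polar hr (hnz 0 h0mem)
  simp only at hl1 hl2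
  obtain ⟨n, hn⟩ := hψ₀ φ (hbdry h0mem (Or.inl rfl) (by rw [one_mul, hl1]) (by rw [one_mul, hl2])
    hy.bc.left)
  -- the sign `ε` accounts for the initial angle being prescribed only modulo `π`
  obtain ⟨ε, hε, hεs, hεc⟩ : ∃ ε : ℝ, (ε = 1 ∨ ε = -1) ∧ Real.sin φ = ε * Real.sin ψ₀ ∧
      Real.cos φ = ε * Real.cos ψ₀ := by
    refine ⟨(-1) ^ n, ?_, ?_, ?_⟩
    · rcases Int.even_or_odd n with h | h
      · exact Or.inl h.neg_one_zpow
      · exact Or.inr h.neg_one_zpow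
    · rw [hn, Real.sin_add_int_mul_pi]
    · rw [hn, Real.cos_add_int_mul_pi]
  have hεε : ε * ε = 1 := by rcases hε with rfl | rfl <;> norm_num
  have hfl' : IsFlow r (fun x => ε * y x) (fun x => ε * v x)
      (fun x => ε * (r * (q x * spow r (y x) - w x * f (y x)))) := by
    refine ⟨fun x hx => ?_, fun x hx => (hfl.deriv_snd x hx).const_mul ε⟩
    refine ((hfl.deriv_fst x hx).const_mul ε).congr_deriv ?_
    rcases hε with rfl | rfl
    · rw [one_mul, one_mul]
    · rw [neg_one_mul, neg_one_mul, spow_neg]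
  obtain ⟨L, ψ, hψ0, hψ⟩ := hfl'.exists_polar hr (continuousOn_const.mul hNc)
    (fun x hx h => hnz x hx (by
      have hε0 : ε ≠ 0 := fun h => by simp [h] at hεε
      simpa [Prod.mk_eq_zero, hε0] using h)) (l := l) (ψ₀ := ψ₀)
    (by linear_combination ε * hl1 + ε * Real.exp l * hεs + Real.exp l * Real.sin ψ₀ * hεε)
    (by linear_combination ε * hl2 + ε * Real.exp l ^ r * hεc +
      Real.exp l ^ r * Real.cos ψ₀ * hεε)
  refine ⟨ψ, hψ0, hbdry h1mem hε (hψ 1 h1mem).1 (hψ 1 h1mem).2.1 hy.bc.right, fun x hx => ?_,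
    fun x hx => ?_⟩
  · obtain ⟨h1, -, h3⟩ := hψ x hx
    refine h3.congr_deriv ?_
    have he := Real.exp_pos (L x)
    have her : 0 < Real.exp (L x) ^ r := Real.rpow_pos_of_pos he r
    have hD := (angleDen_pos hr (ψ x)).ne'
    have e1 : ε * spow r (y x) = Real.exp (L x) ^ r * spow r (Real.sin (ψ x)) := by
      rw [← spow_mul_of_pos _ he, ← h1]
      rcases hε with rfl | rfl
      · rw [one_mul, one_mul]
      · rw [neg_one_mul, neg_one_mul, spow_neg]
    -- `f` is odd, so `f(y) sin ψ` only involves `|y|`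
    have e2 : ε * f (y x) * Real.sin (ψ x) * |y x| ^ r =
        f |y x| * Real.exp (L x) ^ r * |Real.sin (ψ x)| ^ (r + 1) := by
      have hodd : ∀ u, f (-u) = -f u := fun u => by
        rcases lt_trichotomy u 0 with hu | hu | hu
        · have := hfo (-u) (by linarith)
          rw [neg_neg] at this
          rw [this, neg_neg]
        · rw [hu, neg_zero, oddPos_zero hf hfo, neg_zero]
        · exact hfo u hu
      have a1 : ε * f (y x) = f (Real.exp (L x) * Real.sin (ψ x)) := by
        rw [← h1]
        rcases hε with rfl | rfl
        · rw [one_mul, one_mul]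
        · rw [neg_one_mul, neg_one_mul, hodd]
      have a2 : |y x| = Real.exp (L x) * |Real.sin (ψ x)| := by
        have := congrArg abs h1
        rw [abs_mul, abs_mul, abs_of_pos he] at this
        rcases hε with rfl | rfl <;> simpa using this
      have a3 : f (Real.exp (L x) * Real.sin (ψ x)) * Real.sin (ψ x) =
          f (Real.exp (L x) * |Real.sin (ψ x)|) * |Real.sin (ψ x)| := by
        rcases abs_choice (Real.sin (ψ x)) with h | h
        · rw [h]
        · rw [h, mul_neg, mul_neg, hodd]; ring
      rw [a1, a2, a3, Real.mul_rpow he.le (abs_nonneg _),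
        Real.rpow_add_one' (abs_nonneg _) (by positivity)]
      ring
    have hs := mul_spow_self hr (Real.sin (ψ x))
    have key : -(ε * (r * (q x * spow r (y x) - w x * f (y x))) * (Real.exp (L x) ^ r)⁻¹ *
        Real.sin (ψ x)) =
          (w x * (f |y x| / |y x| ^ r) - q x) * (r * |Real.sin (ψ x)| ^ (r + 1)) := by
      by_cases h0 : Real.sin (ψ x) = 0
      · rw [h0, abs_zero, Real.zero_rpow (by positivity)]; ring
      · have hy0 : y x ≠ 0 := fun h => by
          rw [h, mul_zero] at h1
          exact (mul_ne_zero he.ne' h0) h1.symm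
        have hyr : |y x| ^ r ≠ 0 := (Real.rpow_pos_of_pos (abs_pos.2 hy0) r).ne'
        have a4 : ε * f (y x) * Real.sin (ψ x) * (Real.exp (L x) ^ r)⁻¹ =
            f |y x| / |y x| ^ r * |Real.sin (ψ x)| ^ (r + 1) := by
          field_simp
          linear_combination e2
        have a5 : ε * spow r (y x) * (Real.exp (L x) ^ r)⁻¹ = spow r (Real.sin (ψ x)) := by
          rw [e1]; field_simp
        linear_combination (r * w x) * a4 - (r * q x * Real.sin (ψ x)) * a5 - r * q x * hs
    rw [angleSpeed, angleFree, anglePot, sub_eq_add_neg, key]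
    ring
  · have h1 := (hψ x hx).1
    constructor
    · intro h
      rw [h, mul_zero] at h1
      exact (mul_eq_zero.1 h1.symm).resolve_left (Real.exp_pos _).ne'
    · intro h
      rw [h, mul_zero] at h1
      rcases hε with rfl | rfl <;> simpa using h1

/-- An eigenfunction solves the nonlinear problem with `f(s) = s^{(p-1)}` and a shifted `q`. -/
theorem IsEigenfunction.isSolution {p : ℝ} {q w y : ℝ → ℝ} {α β μ : ℝ}
    (h : IsEigenfunction p q w α β μ y) :
    IsSolution p (fun x => q x - (μ - 1) * w x) w (spow (p - 1)) α β y := by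
  refine ⟨h.regular, fun x hx => ?_, h.bc⟩
  rw [h.equation x hx]
  ring

/-! ### Nondegeneracy of the boundary conditions -/

section Sinp

variable {p : ℝ}

theorem sinpDensity_bounds (hp : 1 < p) {t : ℝ} (ht : t ∈ Ioo (0 : ℝ) 1) :
    1 ≤ 1 / (1 - t ^ p) ^ (1 / p) ∧ 1 / (1 - t ^ p) ^ (1 / p) ≤ (1 - t) ^ (-(1 / p)) := by
  have hp0 : 0 < 1 / p := by positivity
  have h1 : t ^ p ≤ t := by
    simpa using Real.rpow_le_rpow_of_exponent_ge ht.1 ht.2.le hp.le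
  have h2 : 0 < t ^ p := Real.rpow_pos_of_pos ht.1 p
  have h3 : 0 < 1 - t := by linarith [ht.2]
  have h4 : 0 < (1 - t ^ p) ^ (1 / p) := Real.rpow_pos_of_pos (by linarith) _
  constructor
  · rw [one_le_div h4]
    exact Real.rpow_le_one (by linarith) (by linarith) hp0.le
  · rw [Real.rpow_neg h3.le, one_div]
    exact inv_anti₀ (Real.rpow_pos_of_pos h3 _) (Real.rpow_le_rpow h3.le (by linarith) hp0.le)

theorem measurable_sinpDensity (p : ℝ) :
    Measurable fun t : ℝ => 1 / (1 - t ^ p) ^ (1 / p) := by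
  fun_prop

theorem intervalIntegrable_sinpDensity (hp : 1 < p) :
    IntervalIntegrable (fun t : ℝ => 1 / (1 - t ^ p) ^ (1 / p)) MeasureTheory.volume 0 1 := by
  have h1 : IntervalIntegrable (fun t : ℝ => (1 - t) ^ (-(1 / p))) MeasureTheory.volume 0 1 := by
    have h : -1 < -(1 / p) := by
      have : 1 / p < 1 := by rw [div_lt_one (by linarith)]; exact hp
      linarith
    simpa using (intervalIntegral.intervalIntegrable_rpow' (a := 1) (b := 0) h).comp_sub_left 1
  rw [intervalIntegrable_iff_integrableOn_Ioo_of_le zero_le_one] at h1 ⊢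
  refine h1.mono' (measurable_sinpDensity p).aestronglyMeasurable ?_
  filter_upwards [MeasureTheory.ae_restrict_mem measurableSet_Ioo] with t ht
  obtain ⟨h2, h3⟩ := sinpDensity_bounds hp ht
  rwa [Real.norm_of_nonneg (zero_le_one.trans h2)]

/-- The integrand defining `arcsinp` is at least `1`. -/
theorem sub_le_arcsinp_sub (hp : 1 < p) {s t : ℝ} (hs : 0 ≤ s) (hst : s ≤ t) (ht : t ≤ 1) :
    t - s ≤ arcsinp p t - arcsinp p s := by
  have hint := intervalIntegrable_sinpDensity hp
  have hsub : ∀ {a b : ℝ}, 0 ≤ a → a ≤ b → b ≤ 1 → IntervalIntegrable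
      (fun t : ℝ => 1 / (1 - t ^ p) ^ (1 / p)) MeasureTheory.volume a b := fun h1 h2 h3 =>
    hint.mono_set (by
      rw [uIcc_of_le h2, uIcc_of_le zero_le_one]; exact Icc_subset_Icc h1 h3)
  rw [arcsinp, arcsinp, intervalIntegral.integral_interval_sub_left
    (hsub le_rfl (hs.trans hst) ht) (hsub le_rfl hs (hst.trans ht))]
  have h1 : ∫ _ in s..t, (1 : ℝ) = t - s := by simp
  rw [← h1]
  refine intervalIntegral.integral_mono_on_of_le_Ioo hst (by simp) (hsub hs hst ht) fun x hx => ?_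
  exact (sinpDensity_bounds hp ⟨hs.trans_lt hx.1, hx.2.trans_le ht⟩).1

theorem arcsinp_zero (p : ℝ) : arcsinp p 0 = 0 := intervalIntegral.integral_same

theorem arcsinp_one (p : ℝ) : arcsinp p 1 = pip p / 2 := by
  have : pip p = 2 * arcsinp p 1 := by
    rw [pip, arcsinp, ← intervalIntegral.integral_const_mul]
    congr 1
    funext t
    ring
  rw [this]; ring

theorem pip_pos (hp : 1 < p) : 0 < pip p := by
  have := sub_le_arcsinp_sub hp le_rfl zero_le_one le_rfl
  rw [arcsinp_zero, arcsinp_one] at this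
  linarith

theorem sinpQuarter_spec (hp : 1 < p) {x : ℝ} (hx : x ∈ Icc 0 (pip p / 2)) :
    sinpQuarter p x ∈ Icc (0 : ℝ) 1 ∧ arcsinp p (sinpQuarter p x) = x := by
  have hc : ContinuousOn (arcsinp p) (Icc 0 1) := by
    have := intervalIntegral.continuousOn_primitive_interval'
      (intervalIntegrable_sinpDensity hp) left_mem_uIcc
    rwa [uIcc_of_le zero_le_one] at this
  have hmem : x ∈ arcsinp p '' Icc 0 1 := by
    refine intermediate_value_Icc zero_le_one hc ?_
    rwa [arcsinp_zero, arcsinp_one]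
  exact ⟨Function.invFunOn_mem hmem, Function.invFunOn_eq hmem⟩

theorem sinpQuarter_pos (hp : 1 < p) {x : ℝ} (hx : x ∈ Ioc 0 (pip p / 2)) :
    0 < sinpQuarter p x ∧ sinpQuarter p x ≤ x := by
  obtain ⟨h1, h2⟩ := sinpQuarter_spec hp (Ioc_subset_Icc_self hx)
  have h3 := sub_le_arcsinp_sub hp le_rfl h1.1 h1.2
  rw [h2, arcsinp_zero] at h3
  refine ⟨lt_of_le_of_ne h1.1 fun h => ?_, by linarith⟩
  rw [← h, arcsinp_zero] at h2
  exact hx.1.ne h2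

theorem sinpQuarter_zero (hp : 1 < p) : sinpQuarter p 0 = 0 := by
  obtain ⟨h1, h2⟩ := sinpQuarter_spec hp (x := 0) ⟨le_rfl, by linarith [pip_pos hp]⟩
  have h3 := sub_le_arcsinp_sub hp le_rfl h1.1 h1.2
  rw [h2, arcsinp_zero] at h3
  linarith [h1.1]

theorem hasDerivAt_arcsinp_zero (hp : 1 < p) : HasDerivAt (arcsinp p) 1 0 := by
  have hc : ContinuousAt (fun t : ℝ => 1 / (1 - t ^ p) ^ (1 / p)) 0 := by
    have h0 : (0 : ℝ) ^ p = 0 := Real.zero_rpow (by linarith)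
    have h1 : ContinuousAt (fun t : ℝ => t ^ p) 0 :=
      Real.continuousAt_rpow_const _ _ (Or.inr (by linarith))
    have h2 : ContinuousAt (fun t : ℝ => (1 - t ^ p) ^ (1 / p)) 0 :=
      (continuousAt_const.sub h1).rpow_const (Or.inl (by simp [h0]))
    exact continuousAt_const.div h2 (by simp [h0])
  have h := intervalIntegral.integral_hasDerivAt_right (a := 0) (b := 0) (by simp)
    ((measurable_sinpDensity p).stronglyMeasurable.stronglyMeasurableAtFilter) hc
  have h0 : (0 : ℝ) ^ p = 0 := Real.zero_rpow (by linarith)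
  exact h.congr_deriv (by simp [h0])

theorem hasDerivWithinAt_sinpQuarter_zero (hp : 1 < p) :
    HasDerivWithinAt (sinpQuarter p) 1 (Ici 0) 0 := by
  have hπ := pip_pos hp
  rw [← hasDerivWithinAt_Ioi_iff_Ici, hasDerivWithinAt_iff_tendsto_slope' (by simp)]
  have h1 := (hasDerivAt_iff_tendsto_slope.1 (hasDerivAt_arcsinp_zero hp)).inv₀ one_ne_zero
  have hnear : ∀ᶠ x in 𝓝[>] (0 : ℝ), x ∈ Ioc 0 (pip p / 2) :=
    Ioc_mem_nhdsGT (by linarith)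
  have h2 : Tendsto (sinpQuarter p) (𝓝[>] 0) (𝓝[≠] 0) := by
    refine tendsto_nhdsWithin_iff.2 ⟨?_, hnear.mono fun x hx => (sinpQuarter_pos hp hx).1.ne'⟩
    refine tendsto_of_tendsto_of_tendsto_of_le_of_le' tendsto_const_nhds
      (tendsto_id.mono_left nhdsWithin_le_nhds)
      (hnear.mono fun x hx => (sinpQuarter_pos hp hx).1.le)
      (hnear.mono fun x hx => (sinpQuarter_pos hp hx).2)
  have h3 := h1.comp h2
  rw [inv_one] at h3
  refine h3.congr' (hnear.mono fun x hx => ?_)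
  have h4 := (sinpQuarter_spec hp (Ioc_subset_Icc_self hx)).2
  simp only [Function.comp_apply, slope_def_field, h4, arcsinp_zero, sinpQuarter_zero hp, sub_zero,
    inv_div]

/-- Two odd one-sided copies of `sinpQuarter` fit together differentiably at `0`. -/
theorem hasDerivAt_of_eq_sinpQuarter (hp : 1 < p) {g : ℝ → ℝ} {ε : ℝ}
    (h1 : ∀ u ∈ Ico 0 (pip p / 2), g u = ε * sinpQuarter p u)
    (h2 : ∀ u ∈ Ioo (-(pip p / 2)) 0, g u = -(ε * sinpQuarter p (-u))) : HasDerivAt g ε 0 := by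
  have hπ := pip_pos hp
  have hq := hasDerivWithinAt_sinpQuarter_zero hp
  have hg0 : g 0 = 0 := by rw [h1 0 ⟨le_rfl, by linarith⟩, sinpQuarter_zero hp, mul_zero]
  have hr : HasDerivWithinAt g ε (Ici 0) 0 := by
    refine ((hq.const_mul ε).congr_deriv (mul_one ε)).congr_of_eventuallyEq
      (mem_of_superset (Ico_mem_nhdsGE (by linarith)) h1) (h1 0 ⟨le_rfl, by linarith⟩)
  have hl : HasDerivWithinAt g ε (Iic 0) 0 := by
    have hneg : HasDerivWithinAt (fun u => sinpQuarter p (-u)) (1 * -1) (Iic 0) 0 := by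
      refine HasDerivWithinAt.comp (h₂ := sinpQuarter p) (h := fun u : ℝ => -u) (s' := Ici 0) 0
        (by simpa using hq) (hasDerivAt_neg 0).hasDerivWithinAt fun u hu => ?_
      simpa using hu
    refine ((hneg.const_mul ε).neg.congr_deriv (by ring)).congr_of_eventuallyEq
      (mem_of_superset (Ioc_mem_nhdsLE (by linarith : -(pip p / 2) < 0)) fun u hu => ?_)
      (by simp [hg0, sinpQuarter_zero hp])
    rcases hu.2.eq_or_lt with h | h
    · simp [h, hg0, sinpQuarter_zero hp]
    · exact h2 u ⟨hu.1, h⟩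
  simpa using hl.union hr

theorem sinp_of_mem_Ico (hp : 1 < p) {x : ℝ} (n : ℤ)
    (hx : x - 2 * pip p * n ∈ Ico 0 (2 * pip p)) : sinp p x =
      if x - 2 * pip p * n ≤ pip p then sinpHalf p (x - 2 * pip p * n)
      else -sinpHalf p (x - 2 * pip p * n - pip p) := by
  have hπ := pip_pos hp
  have : ⌊x / (2 * pip p)⌋ = n := by
    rw [Int.floor_eq_iff, le_div_iff₀ (by linarith), div_lt_iff₀ (by linarith)]
    constructor <;> nlinarith [hx.1, hx.2]
  simp only [sinp, this]

theorem sinp_pos (hp : 1 < p) {x : ℝ} (hx : x ∈ Ioo 0 (pip p)) : 0 < sinp p x := by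
  have hπ := pip_pos hp
  rw [sinp_of_mem_Ico hp 0 (by simpa using ⟨hx.1.le, by linarith [hx.2]⟩)]
  simp only [Int.cast_zero, mul_zero, sub_zero, hx.2.le, if_true, sinpHalf]
  split_ifs with h
  · exact (sinpQuarter_pos hp ⟨hx.1, h⟩).1
  · exact (sinpQuarter_pos hp ⟨by linarith [hx.2], by linarith⟩).1

theorem hasDerivAt_sinp_zero (hp : 1 < p) : HasDerivAt (sinp p) 1 0 := by
  have hπ := pip_pos hp
  refine hasDerivAt_of_eq_sinpQuarter hp (fun u hu => ?_) fun u hu => ?_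
  · rw [sinp_of_mem_Ico hp 0 (by simpa using ⟨hu.1, by linarith [hu.2]⟩)]
    simp only [Int.cast_zero, mul_zero, sub_zero, sinpHalf]
    rw [if_pos (by linarith [hu.2]), if_pos hu.2.le, one_mul]
  · have e : u - 2 * pip p * ((-1 : ℤ) : ℝ) = u + 2 * pip p := by push_cast; ring
    rw [sinp_of_mem_Ico hp (-1) (by rw [e]; exact ⟨by linarith [hu.1], by linarith [hu.2]⟩), e,
      if_neg (by linarith [hu.1]), sinpHalf, if_neg (by linarith [hu.1]), one_mul]
    congr 2
    ring

theorem hasDerivAt_sinp_pip (hp : 1 < p) : HasDerivAt (sinp p) (-1) (pip p) := by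
  have hπ := pip_pos hp
  have h : HasDerivAt (fun u => sinp p (u + pip p)) (-1) 0 := by
    refine hasDerivAt_of_eq_sinpQuarter hp (fun u hu => ?_) fun u hu => ?_
    · rw [sinp_of_mem_Ico hp 0 (by simpa using ⟨by linarith [hu.1], by linarith [hu.2]⟩)]
      simp only [Int.cast_zero, mul_zero, sub_zero, sinpHalf]
      rcases hu.1.eq_or_lt with h | h
      · rw [← h, if_pos (by linarith), if_neg (by linarith)]
        simp [sinpQuarter_zero hp]
      · rw [if_neg (by linarith), if_pos (by linarith [hu.2]), add_sub_cancel_right, neg_one_mul]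
    · rw [sinp_of_mem_Ico hp 0 (by simpa using ⟨by linarith [hu.1], by linarith [hu.2]⟩)]
      simp only [Int.cast_zero, mul_zero, sub_zero, sinpHalf]
      rw [if_pos (by linarith [hu.2]), if_neg (by linarith [hu.1]), neg_one_mul, neg_neg]
      congr 1
      ring
  rw [← sub_self (pip p)] at h
  simpa using h.comp_sub_const (pip p) (pip p)

/-- The vector of coefficients of a boundary condition does not vanish. -/
theorem sinp_nondegenerate (hp : 1 < p) {x : ℝ} (hx : x ∈ Icc 0 (pip p)) :
    ¬(deriv (sinp p) x = 0 ∧ sinp p x = 0) := by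
  rintro ⟨h1, h2⟩
  rcases hx.1.eq_or_lt with h | h
  · rw [← h, (hasDerivAt_sinp_zero hp).deriv] at h1
    exact one_ne_zero h1
  · rcases hx.2.eq_or_lt with h' | h'
    · rw [h', (hasDerivAt_sinp_pip hp).deriv] at h1
      exact neg_ne_zero.2 one_ne_zero h1
    · exact (sinp_pos hp ⟨h, h'⟩).ne' h2

end Sinp

/-! ### Eigenvalues and zeros -/

theorem HasZeros.nonzeroFun {y : ℝ → ℝ} {i : ℕ} (h : HasZeros y i) : NonzeroFun y := by
  by_contra hc
  have hy : ∀ x ∈ Icc (0 : ℝ) 1, y x = 0 := by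
    simpa [NonzeroFun] using hc
  have heq : {x ∈ Ioo (0 : ℝ) 1 | y x = 0} = Ioo (0 : ℝ) 1 :=
    Set.ext fun x => ⟨fun hx => hx.1, fun hx => ⟨hx, hy x (Ioo_subset_Icc_self hx)⟩⟩
  rw [HasZeros, heq, (Ioo_infinite zero_lt_one).encard_eq] at h
  exact ENat.top_ne_natCast i h

theorem HasZeros.unique {y : ℝ → ℝ} {i j : ℕ} (hi : HasZeros y i) (hj : HasZeros y j) : i = j := by
  exact_mod_cast hi.symm.trans hj

theorem hasZeros_of_isAngle {r : ℝ} (hr : 0 < r) {k ψ y : ℝ → ℝ} (h : IsAngle r k ψ)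
    (h0 : ψ 0 ∈ Ico 0 Real.pi) {β₀ : ℝ} (hβ₀ : β₀ ∈ Ioc 0 Real.pi) {n : ℕ}
    (h1 : ψ 1 = β₀ + n * Real.pi) (hz : ∀ x ∈ Icc (0 : ℝ) 1, y x = 0 ↔ Real.sin (ψ x) = 0) :
    HasZeros y n := by
  rw [HasZeros, ← h.encard_zeros hr h0 (n := n)
    (by rw [h1]; constructor <;> nlinarith [hβ₀.1, hβ₀.2])]
  congr 1
  ext x
  simp only [mem_ofPred_eq]
  exact and_congr_right fun hx => hz x (Ioo_subset_Icc_self hx)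

/-- The terminal angle is positive, so the boundary condition at `1` selects a natural number. -/
theorem IsAngle.exists_nat_terminal {r : ℝ} (hr : 0 < r) {k ψ : ℝ → ℝ} (h : IsAngle r k ψ)
    (h0 : 0 ≤ ψ 0) {β₀ : ℝ} (hβ₀ : β₀ ≤ Real.pi) (h1 : ∃ m : ℤ, ψ 1 = β₀ + m * Real.pi) :
    ∃ n : ℕ, ψ 1 = β₀ + n * Real.pi := by
  obtain ⟨m, hm⟩ := h1
  have hpos := h.lt_of_le hr (n := 0) le_rfl zero_lt_one le_rfl (by simpa using h0)
  rw [hm, Int.cast_zero, zero_mul] at hpos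
  have hm0 : -1 < m := by
    have : (-1 : ℝ) < m := by nlinarith [Real.pi_pos]
    exact_mod_cast this
  lift m to ℕ using by omega
  exact ⟨m, by simpa using hm⟩

theorem exists_isBoundaryAngle_iff_Ioc {r c s : ℝ} (hr : 0 < r) (hcs : ¬(c = 0 ∧ s = 0)) :
    ∃ ψ₀ ∈ Ioc 0 Real.pi, ∀ ψ, IsBoundaryAngle r c s ψ ↔ ∃ n : ℤ, ψ = ψ₀ + n * Real.pi := by
  obtain ⟨ψ₀, hψ₀, h⟩ := exists_isBoundaryAngle_iff hr hcs
  rcases hψ₀.1.eq_or_lt with h0 | h0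
  · refine ⟨Real.pi, ⟨Real.pi_pos, le_rfl⟩, fun ψ => (h ψ).trans ⟨?_, ?_⟩⟩
    · rintro ⟨n, rfl⟩
      exact ⟨n - 1, by push_cast; linarith⟩
    · rintro ⟨n, rfl⟩
      exact ⟨n + 1, by push_cast; linarith⟩
  · exact ⟨ψ₀, ⟨h0, hψ₀.2.le⟩, h⟩

/-- An angle function meeting both boundary conditions yields an eigenfunction. -/
theorem IsAngle.isEigenvalue {p : ℝ} (hp : 1 < p) {q w ψ : ℝ → ℝ} {α β μ : ℝ}
    (hk : ContinuousOn (fun x => μ * w x - q x) (Icc 0 1))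
    (h : IsAngle (p - 1) (fun x => μ * w x - q x) ψ)
    (hα : IsBoundaryAngle (p - 1) (deriv (sinp p) α) (sinp p α) (ψ 0))
    (hβ : IsBoundaryAngle (p - 1) (deriv (sinp p) β) (sinp p β) (ψ 1)) :
    IsEigenvalue p q w α β μ := by
  have hr : 0 < p - 1 := by linarith
  unfold IsBoundaryAngle at hα hβ
  obtain ⟨L, y, v, hfl, hy, hv⟩ := h.exists_isFlow hr hk
  have hdI : ∀ x ∈ Icc (0 : ℝ) 1,
      dI y x = Real.exp (L x) * spow (p - 1)⁻¹ (Real.cos (ψ x)) := fun x hx => by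
    rw [hfl.dI_eq hx, hv, spow_mul_of_pos _ (Real.rpow_pos_of_pos (Real.exp_pos _) _),
      Real.rpow_rpow_inv (Real.exp_pos _).le hr.ne']
  refine ⟨y, hfl.isRegular hp, fun x hx => ?_, ⟨?_, ?_⟩, ?_⟩
  · rw [(hfl.hasDerivAt_flux hp hx).deriv, neg_neg]
  · rw [hdI 0 (left_mem_Icc.2 zero_le_one), hy]
    linear_combination Real.exp (L 0) * hα
  · rw [hdI 1 (right_mem_Icc.2 zero_le_one), hy]
    linear_combination Real.exp (L 1) * hβ
  · obtain ⟨x, hx, hs⟩ := h.exists_sin_ne_zero hr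
    exact ⟨x, hx, by rw [hy]; exact mul_ne_zero (Real.exp_pos _).ne' hs⟩

end

end PLap

theorem theorem1p1 (p : ℝ) (hp : 1 < p) (q w : ℝ → ℝ) (hqw : PLap.Coefficients q w)
    (α β : ℝ) (hα : α ∈ Set.Ico 0 (PLap.pip p)) (hβ : β ∈ Set.Ioc 0 (PLap.pip p)) :
    ∃ ev : ℕ → ℝ,
      -- `ev` lists all eigenvalues in increasing order
      StrictMono ev ∧
      (∀ μ : ℝ, PLap.IsEigenvalue p q w α β μ ↔ ∃ n, ev n = μ) ∧
      Filter.Tendsto ev Filter.atTop Filter.atTop ∧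
      (∀ (n : ℕ) (y : ℝ → ℝ), PLap.IsEigenfunction p q w α β (ev n) y → PLap.HasZeros y n) ∧
      ∀ f : ℝ → ℝ, PLap.Nonlinearity p f →
        (∀ n : ℕ, (∀ s : ℝ, 0 < s → f s / s ^ (p - 1) < ev n) →
          ∀ i : ℕ, n ≤ i → ¬ ∃ y, PLap.IsSolution p q w f α β y ∧ PLap.HasZeros y i) ∧
        (∀ n : ℕ, (∀ s : ℝ, 0 < s → ev n < f s / s ^ (p - 1)) →
          ∀ i : ℕ, i ≤ n → ¬ ∃ y, PLap.IsSolution p q w f α β y ∧ PLap.HasZeros y i) ∧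
        ((∀ s : ℝ, 0 < s → ∀ n : ℕ, f s / s ^ (p - 1) ≠ ev n) →
          ¬ ∃ y, PLap.IsSolution p q w f α β y ∧ PLap.NonzeroFun y) := by
  have hr : 0 < p - 1 := by linarith
  have hπ := Real.pi_pos
  have hqc := hqw.q_contDiffOn.continuousOn
  have hwc := hqw.w_contDiffOn.continuousOn
  have hw0 := hqw.w_pos
  obtain ⟨α₀, hα₀, hαiff⟩ := PLap.exists_isBoundaryAngle_iff hr
    (PLap.sinp_nondegenerate hp (Ico_subset_Icc_self hα))
  obtain ⟨β₀, hβ₀, hβiff⟩ := PLap.exists_isBoundaryAngle_iff_Ioc hr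
    (PLap.sinp_nondegenerate hp (Ioc_subset_Icc_self hβ))
  obtain ⟨Ψ, hΨ, hmono, hcont, htop, hbot⟩ := PLap.exists_shooting hr hqc hwc hw0 hα₀
  have hkc : ∀ μ : ℝ, ContinuousOn (fun x => μ * w x - q x) (Icc 0 1) := fun μ =>
    (continuousOn_const.mul hwc).sub hqc
  have hex : ∀ n : ℕ, ∃ μ, Ψ μ 1 = β₀ + n * Real.pi := fun n => by
    obtain ⟨μ₁, h₁⟩ := hbot β₀ hβ₀.1
    obtain ⟨μ₂, h₂⟩ := htop (β₀ + n * Real.pi)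
    exact mem_range_of_exists_le_of_exists_ge hcont ⟨μ₁, h₁.le.trans (by
      have : 0 ≤ (n : ℝ) * Real.pi := by positivity
      linarith)⟩ ⟨μ₂, h₂⟩
  choose ev hev using hex
  have hevmono : StrictMono ev := fun m n hmn => by
    rw [← hmono.lt_iff_lt, hev, hev]
    have : (m : ℝ) < n := by exact_mod_cast hmn
    nlinarith
  -- the angle of an eigenfunction is the one of the shooting problem
  have heig : ∀ μ y, PLap.IsEigenfunction p q w α β μ y → ∃ n : ℕ, Ψ μ 1 = β₀ + n * Real.pi ∧
      PLap.HasZeros y n := by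
    intro μ y hy
    have hspos : ∀ s : ℝ, 0 < s → PLap.spow (p - 1) s = s ^ (p - 1) := fun s hs =>
      PLap.spow_of_pos _ hs
    obtain ⟨ψ, h0, h1, hang, hzero⟩ := hy.isSolution.exists_isAngle
      (q := fun x => q x - (μ - 1) * w x) hp
      (hqc.sub (continuousOn_const.mul hwc)) hqw.w_contDiffOn hw0 (PLap.continuous_spow hr)
      (fun s hs => by rw [hspos s hs]; exact Real.rpow_pos_of_pos hs _)
      (fun s _ => PLap.spow_neg _ s) hy.nontrivial fun φ hφ => (hαiff φ).1 hφ
    have hEq := hang.eqOn hr (hkc μ) (hΨ μ).2 (h0.trans (hΨ μ).1.symm) fun x hx hs => by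
      have hyx : 0 < |y x| := abs_pos.2 fun h => hs ((hzero x hx).1 h)
      rw [hspos _ hyx, div_self (Real.rpow_pos_of_pos hyx _).ne']
      ring
    obtain ⟨n, hn⟩ := hang.exists_nat_terminal hr (by rw [h0]; exact hα₀.1) hβ₀.2 ((hβiff _).1 h1)
    exact ⟨n, by rw [← hEq (right_mem_Icc.2 zero_le_one)]; exact hn,
      PLap.hasZeros_of_isAngle hr hang (by rw [h0]; exact hα₀) hβ₀ hn hzero⟩
  refine ⟨ev, hevmono, fun μ => ⟨?_, ?_⟩, ?_, fun n y hy => ?_, fun f hf => ?_⟩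
  · rintro ⟨y, hy⟩
    obtain ⟨n, hn, -⟩ := heig μ y hy
    exact ⟨n, hmono.injective ((hev n).trans hn.symm)⟩
  · rintro ⟨n, rfl⟩
    exact (hΨ (ev n)).2.isEigenvalue hp (hkc _)
      ((hαiff _).2 ⟨0, by rw [(hΨ (ev n)).1]; simp⟩) ((hβiff _).2 ⟨n, by rw [hev]; simp⟩)
  · refine tendsto_atTop_atTop_of_monotone hevmono.monotone fun M => ?_
    obtain ⟨n, hn⟩ := exists_nat_gt (Ψ M 1 / Real.pi)
    refine ⟨n, hmono.le_iff_le.1 ?_⟩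
    rw [div_lt_iff₀ hπ] at hn
    rw [hev]
    linarith [hβ₀.1]
  · obtain ⟨m, hm, hz⟩ := heig (ev n) y hy
    have : (n : ℝ) = m := by
      rw [hev] at hm
      exact mul_right_cancel₀ hπ.ne' (add_left_cancel hm)
    rwa [Nat.cast_injective this]
  · -- the zeros of a nontrivial solution are compared with those of the eigenfunctions
    have hsol : ∀ y, PLap.IsSolution p q w f α β y → PLap.NonzeroFun y → ∃ i : ℕ,
        PLap.HasZeros y i ∧
        (∀ n : ℕ, (∀ s : ℝ, 0 < s → f s / s ^ (p - 1) < ev n) → i < n) ∧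
        (∀ n : ℕ, (∀ s : ℝ, 0 < s → ev n < f s / s ^ (p - 1)) → n < i) := by
      intro y hy hne
      obtain ⟨ψ, h0, h1, hang, hzero⟩ := hy.exists_isAngle hp hqc hqw.w_contDiffOn hw0
        hf.continuous hf.pos hf.odd hne fun φ hφ => (hαiff φ).1 hφ
      obtain ⟨i, hi⟩ := hang.exists_nat_terminal hr (by rw [h0]; exact hα₀.1) hβ₀.2
        ((hβiff _).1 h1)
      have hlt : ∀ {m n : ℕ}, β₀ + m * Real.pi < β₀ + n * Real.pi → m < n := fun h => by
        exact_mod_cast lt_of_mul_lt_mul_right (lt_of_add_lt_add_left h) hπ.le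
      have hyx : ∀ x ∈ Icc (0 : ℝ) 1, Real.sin (ψ x) ≠ 0 → 0 < |y x| := fun x hx hs =>
        abs_pos.2 fun h => hs ((hzero x hx).1 h)
      refine ⟨i, PLap.hasZeros_of_isAngle hr hang (by rw [h0]; exact hα₀) hβ₀ hi hzero,
        fun n hn => hlt ?_, fun n hn => hlt ?_⟩
      · rw [← hi, ← hev]
        refine hang.lt_of_lt_continuousOn hr (hkc _) (hΨ _).2 (h0.trans (hΨ _).1.symm)
          fun x hx hs => ?_
        have := mul_lt_mul_of_pos_left (hn _ (hyx x hx hs)) (hw0 x hx)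
        linarith
      · rw [← hi, ← hev]
        refine (hΨ _).2.lt_of_continuousOn_lt hr (hkc _) hang ((hΨ _).1.trans h0.symm)
          fun x hx hs => ?_
        have := mul_lt_mul_of_pos_left (hn _ (hyx x hx hs)) (hw0 x hx)
        linarith
    refine ⟨fun n hn i hni => ?_, fun n hn i hin => ?_, fun hn => ?_⟩
    · rintro ⟨y, hy, hz⟩
      obtain ⟨j, hj, h, -⟩ := hsol y hy hz.nonzeroFun
      have := h n hn
      have := hz.unique hj
      omega
    · rintro ⟨y, hy, hz⟩
      obtain ⟨j, hj, -, h⟩ := hsol y hy hz.nonzeroFun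
      have := h n hn
      have := hz.unique hj
      omega
    · -- by connectedness the quotient stays on one side of the eigenvalue with the same zero count
      rintro ⟨y, hy, hne⟩
      obtain ⟨i, -, h₁, h₂⟩ := hsol y hy hne
      have hc : ContinuousOn (fun s : ℝ => f s / s ^ (p - 1)) (Ioi 0) :=
        hf.continuous.continuousOn.div
          (fun s hs => (Real.continuousAt_rpow_const _ _ (Or.inl (ne_of_gt hs))).continuousWithinAt)
          fun s hs => (Real.rpow_pos_of_pos hs _).ne'
      by_cases hall : ∀ s : ℝ, 0 < s → f s / s ^ (p - 1) < ev i
      · exact lt_irrefl _ (h₁ i hall)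
      · push Not at hall
        obtain ⟨s, hs, hle⟩ := hall
        refine lt_irrefl _ (h₂ i fun t ht => ?_)
        by_contra! hge
        obtain ⟨u, hu, hui⟩ := isPreconnected_Ioi.intermediate_value (mem_Ioi.2 ht) (mem_Ioi.2 hs)
          hc ⟨hge, hle⟩
        exact hn u hu i hui
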